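/- Let $B_0,B_1,B_2,\dots$ be i.i.d. positive random variables, distributed as $B$, with finite second moment and a probability density $f_B$ on $(0,\infty)$ that is completely monotone: $f_B$ is infinitely differentiable on $(0,\infty)$ and $(-1)^n f_B^{(n)}(x)\ge 0$ for all $x>0$ and $n=0,1,2,\dots$. Let $N(t)$, $t\ge 0$, be a Poisson process with rate $1/\mathbb{E}[B]$, independent of $(B_i)_{i\ge 0}$. For $\rho\in(0,1)$ put $$X^\rho(t)=X_0+\sum_{i=1}^{N(\rho t)}B_i-t,\qquad M_\infty^\rho=\sup_{t\ge 0}X^\rho(t),$$ where the initial value is either $X_0=B_0$ or $X_0=0$ (the same choice for all $\rho$). Let $B^*$ have the excess distribution of $B$, with density $\mathbb{P}(B>x)/\mathbb{E}[B]$ on $(0,\infty)$. Then, for either choice of $X_0$ and every $\rho\in(0,1)$, $M_\infty^\rho$ is almost surely finite and has a density $f_{M_\infty^\rho}$ on $(0,\infty)$: the derivative $f_{M_\infty^\rho}(x)=\frac{\mathrm d}{\mathrm dx}\mathbb{P}(M_\infty^\rho<x)$ exists for every $x>0$, and $\mathbb{P}(M_\infty^\rho\in A)=\int_A f_{M_\infty^\rho}(x)\,\mathrm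 dx$ for every Borel set $A\subseteq(0,\infty)$. Moreover, for every fixed $y>0$, $$\lim_{\rho\uparrow 1}\frac{1}{1-\rho}\,f_{M_\infty^\rho}\!\left(\frac{y}{1-\rho}\right)=\frac{1}{\mathbb{E}[B^*]}\,e^{-y/\mathbb{E}[B^*]}.$$ -/

import Mathlib

open MeasureTheory ProbabilityTheory Set Filter
open scoped NNReal ENNReal Topology

noncomputable section

/-- `f` is completely monotone on `(0,∞)`: all derivatives exist there and alternate in sign. -/
def CompletelyMonotone (f : ℝ → ℝ) : Prop :=
  ContDiffOn ℝ ((⊤ : ℕ∞) : WithTop ℕ∞) f (Ioi 0) ∧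
    ∀ n : ℕ, ∀ x : ℝ, 0 < x → 0 ≤ (-1 : ℝ) ^ n * iteratedDeriv n f x

/-- The measure on `(0,∞)` with density `f`. -/
def measureOfDensity (f : ℝ → ℝ) : Measure ℝ :=
  (volume.restrict (Ioi 0)).withDensity fun x => ENNReal.ofReal (f x)

/-- The density `x ↦ P(B > x) / E[B]` of the excess distribution of a law `ν` on `(0,∞)`. -/
def excessDensity (ν : Measure ℝ) (x : ℝ) : ℝ :=
  ν.real (Ioi x) / ∫ u, u ∂ν

/-- The excess distribution, i.e. the law of `B*` when `B` has law `ν`. -/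
def excessLaw (ν : Measure ℝ) : Measure ℝ :=
  measureOfDensity (excessDensity ν)

/-- `N` is a Poisson process of rate `r`: it counts the arrivals of a point process on `(0,∞)` whose
interarrival times are independent and exponentially distributed with rate `r`. -/
structure IsPoissonProcess {Ω : Type*} [MeasurableSpace Ω] (r : ℝ) (N : ℝ≥0 → Ω → ℕ)
    (P : Measure Ω) : Prop where
  measurable : ∀ t, Measurable (N t)
  exists_interarrival : ∃ A : ℕ → Ω → ℝ,
    iIndepFun A P ∧ (∀ i, HasLaw (A i) (expMeasure r) P) ∧
      ∀ᵐ ω ∂P, ∀ t : ℝ≥0,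
        N t ω = Set.ncard {n : ℕ | ∑ i ∈ Finset.range (n + 1), A i ω ≤ (t : ℝ)}

/-- The process `X^ρ(t) = X₀ + ∑_{i=1}^{N(ρ t)} B_i - t`, with initial value `X₀`. -/
def driftedCompoundPoisson {Ω : Type*} (X₀ : Ω → ℝ) (B : ℕ → Ω → ℝ) (N : ℝ≥0 → Ω → ℕ)
    (ρ : ℝ) (t : ℝ≥0) (ω : Ω) : ℝ :=
  X₀ ω + ∑ i ∈ Finset.Icc 1 (N (ρ.toNNReal * t) ω), B i ω - (t : ℝ)

/-- The all-time supremum `M_∞^ρ = sup_{t ≥ 0} X^ρ(t)`. -/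
def allTimeSup {Ω : Type*} (X₀ : Ω → ℝ) (B : ℕ → Ω → ℝ) (N : ℝ≥0 → Ω → ℕ)
    (ρ : ℝ) (ω : Ω) : ℝ :=
  ⨆ t : ℝ≥0, driftedCompoundPoisson X₀ B N ρ t ω

/-- `f` is the density on `(0,∞)` of the random variable `M`: at every `x > 0` it is the derivative
of `x ↦ P(M < x)`, and integrating it gives the law of `M` on `(0,∞)` (which may have less than
full mass, since `M` may have an atom at `0`). -/
def HasDensityOnPos {Ω : Type*} [MeasurableSpace Ω] (P : Measure Ω) (M : Ω → ℝ)
    (f : ℝ → ℝ) : Prop :=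
  (∀ x : ℝ, 0 < x → HasDerivAt (fun u : ℝ => P.real {ω | M ω < u}) (f x) x) ∧
    ∀ s : Set ℝ, MeasurableSet s → s ⊆ Ioi 0 →
      P {ω | M ω ∈ s} = ∫⁻ x in s, ENNReal.ofReal (f x)

end

/-! Start from X₀ = 0. The path decreases between jumps, so M is the supremum of the random walk
with increments B_{i+1} - A_i/ρ, which has negative drift. Peeling off the first step gives
Lindley's equation for its law m. Because the interarrival times A_i are exponential, characteristic
functions turn this into the Pollaczek-Khinchine equation m = (1-ρ)δ₀ + Γ ∗ m, where Γ is ρ times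
the law of B*. For X₀ = B₀ the law is β ∗ m, with β the law of B.

The equation yields weak convergence of (1-ρ)M to the exponential law of mean E[B*], which is finite
because E[B²] is. Passing from laws to densities needs monotonicity: if the density u of m on (0,∞)
is decreasing, its rescaled values are squeezed between average masses of adjacent intervals, whose
limits are difference quotients of the exponential distribution function.

To see that u decreases, let K = ρ/E[B], G = K P(B > ·) the density of Γ, b = K f, T = 1 - Γ((0,·]),
u = G ∗ m and p = b ∗ m. Complete monotonicity gives P(B > x)² ≤ f(x) ∫_x^∞ P(B > t) dt
(`CompletelyMonotone.sq_tail_le`). Hence the hazard rate r = G/T decreases and r G ≤ b. Formally u'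
= K u - p, and comparing hazard rates, then applying Grönwall, gives K u ≤ p
(`DFRRenewal.conv_G_le_conv_b`); so u decreases (`DFRRenewal.conv_G_anti`).

The same inequality says that the density ψ = p/K of β ∗ m dominates u. In the other direction ψ(x)
≤ u(x-δ) + f(δ), and f(δ/(1-ρ))/(1-ρ) tends to 0 because x f(x) does. So starting from B₀ leads to
the same limit. -/

/-! ### Completely monotone functions and log-convexity of their iterated tails -/

/-- By monotonicity (x/2) f(x) ≤ ∫_{x/2}^x f, and this piece of a convergent integral vanishes as x
→ ∞. -/
theorem tendsto_mul_atTop_of_antitoneOn {f : ℝ → ℝ} (hanti : AntitoneOn f (Ioi 0))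
    (hnn : ∀ x, 0 < x → 0 ≤ f x) (hint : IntegrableOn f (Ioi 1)) :
    Tendsto (fun x => x * f x) atTop (𝓝 0) := by
  have h1 : Tendsto (fun x : ℝ => ∫ t in x..x/2, f t) atTop (𝓝 0) := by
    have hA : Tendsto (fun x : ℝ => ∫ t in (1:ℝ)..x, f t) atTop (𝓝 (∫ t in Ioi 1, f t)) :=
      intervalIntegral_tendsto_integral_Ioi 1 hint tendsto_id
    have hB : Tendsto (fun x : ℝ => ∫ t in (1:ℝ)..x/2, f t) atTop (𝓝 (∫ t in Ioi 1, f t)) :=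
      intervalIntegral_tendsto_integral_Ioi 1 hint (tendsto_id.atTop_div_const two_pos)
    have hC := hB.sub hA
    rw [sub_self] at hC
    refine hC.congr' ?_
    filter_upwards [eventually_ge_atTop (2 : ℝ)] with x hx
    have i1 : IntervalIntegrable f volume 1 x := by
      rw [intervalIntegrable_iff_integrableOn_Ioc_of_le (by linarith)]
      exact hint.mono_set (fun y hy => hy.1)
    have i2 : IntervalIntegrable f volume 1 (x/2) := by
      rw [intervalIntegrable_iff_integrableOn_Ioc_of_le (by linarith)]
      exact hint.mono_set (fun y hy => hy.1)
    exact intervalIntegral.integral_interval_sub_left i2 i1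
  have h2 : Tendsto (fun x : ℝ => 2 * -(∫ t in x..x/2, f t)) atTop (𝓝 0) := by
    simpa using h1.neg.const_mul 2
  refine tendsto_of_tendsto_of_tendsto_of_le_of_le' tendsto_const_nhds h2 ?_ ?_
  · filter_upwards [eventually_gt_atTop (0 : ℝ)] with x hx
    exact mul_nonneg hx.le (hnn x hx)
  · filter_upwards [eventually_ge_atTop (2 : ℝ)] with x hx
    rw [← intervalIntegral.integral_symm]
    have i1 : IntervalIntegrable f volume (x/2) x := by
      rw [intervalIntegrable_iff_integrableOn_Ioc_of_le (by linarith)]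
      exact hint.mono_set (fun y hy => lt_of_le_of_lt (by linarith) hy.1)
    have : ∫ t in (x/2)..x, f x ≤ ∫ t in (x/2)..x, f t := by
      refine intervalIntegral.integral_mono_on (by linarith) (by simp) i1 ?_
      intro t ht
      exact hanti (show 0 < t by linarith [ht.1]) (show 0 < x by linarith) ht.2
    simp at this
    linarith

namespace CompletelyMonotone

variable {f : ℝ → ℝ}

theorem hasDerivAt_signed (hf : CompletelyMonotone f) (n : ℕ) {x : ℝ} (hx : 0 < x) :
    HasDerivAt (fun y => (-1 : ℝ) ^ n * iteratedDeriv n f y)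
      (-((-1 : ℝ) ^ (n + 1) * iteratedDeriv (n + 1) f x)) x := by
  have h1 : DifferentiableOn ℝ (iteratedDerivWithin n f (Ioi 0)) (Ioi 0) :=
    hf.1.differentiableOn_iteratedDerivWithin (by exact_mod_cast ENat.natCast_lt_top n)
      (isOpen_Ioi.uniqueDiffOn)
  have h2 : EqOn (iteratedDerivWithin n f (Ioi 0)) (iteratedDeriv n f) (Ioi 0) :=
    iteratedDerivWithin_of_isOpen isOpen_Ioi
  have h3 : DifferentiableAt ℝ (iteratedDeriv n f) x :=
    ((h1.congr fun y hy => (h2 hy).symm) x hx).differentiableAt (Ioi_mem_nhds hx)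
  have h4 := h3.hasDerivAt.const_mul ((-1 : ℝ) ^ n)
  rw [iteratedDeriv_succ]
  have h5 : -((-1 : ℝ) ^ (n + 1) * deriv (iteratedDeriv n f) x) =
      (-1 : ℝ) ^ n * deriv (iteratedDeriv n f) x := by ring
  rw [h5]
  exact h4

theorem continuousOn_signed (hf : CompletelyMonotone f) (n : ℕ) :
    ContinuousOn (fun y => (-1 : ℝ) ^ n * iteratedDeriv n f y) (Ioi 0) :=
  fun _ hx => (hf.hasDerivAt_signed n hx).continuousAt.continuousWithinAt

theorem antitoneOn_signed (hf : CompletelyMonotone f) (n : ℕ) :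
    AntitoneOn (fun y => (-1 : ℝ) ^ n * iteratedDeriv n f y) (Ioi 0) := by
  refine antitoneOn_of_deriv_nonpos (convex_Ioi 0) (hf.continuousOn_signed n) ?_ ?_
  · intro x hx
    rw [interior_Ioi] at hx
    exact (hf.hasDerivAt_signed n hx).differentiableAt.differentiableWithinAt
  · intro x hx
    rw [interior_Ioi] at hx
    rw [(hf.hasDerivAt_signed n hx).deriv]
    linarith [hf.2 (n + 1) x hx]

theorem nonneg (hf : CompletelyMonotone f) {x : ℝ} (hx : 0 < x) : 0 ≤ f x := by
  simpa using hf.2 0 x hx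

theorem continuousOn (hf : CompletelyMonotone f) : ContinuousOn f (Ioi 0) := hf.1.continuousOn

theorem antitoneOn (hf : CompletelyMonotone f) : AntitoneOn f (Ioi 0) := by
  simpa using hf.antitoneOn_signed 0

/-- The two claims feed each other: an integrable decreasing signed derivative tends to 0, and then
minus its derivative, the next signed derivative, is integrable by the fundamental theorem. One
stays on (a,∞) with a > 0 because the derivatives may blow up at 0. -/
theorem integrableOn_signed (hf : CompletelyMonotone f) (hint : IntegrableOn f (Ioi 0)) (n : ℕ) :
    ∀ a, 0 < a → IntegrableOn (fun y => (-1 : ℝ) ^ n * iteratedDeriv n f y) (Ioi a) ∧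
      Tendsto (fun y => (-1 : ℝ) ^ n * iteratedDeriv n f y) atTop (𝓝 0) := by
  have key : ∀ n : ℕ, (∀ a, 0 < a →
      IntegrableOn (fun y => (-1 : ℝ) ^ n * iteratedDeriv n f y) (Ioi a)) →
      Tendsto (fun y => (-1 : ℝ) ^ n * iteratedDeriv n f y) atTop (𝓝 0) := by
    intro n h
    have h1 := tendsto_mul_atTop_of_antitoneOn (hf.antitoneOn_signed n) (hf.2 n) (h 1 one_pos)
    have h2 := tendsto_inv_atTop_zero.mul h1
    rw [mul_zero] at h2
    refine h2.congr' ?_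
    filter_upwards [eventually_gt_atTop (0 : ℝ)] with x hx
    field_simp
  induction n with
  | zero =>
    have h0 : ∀ a, 0 < a →
        IntegrableOn (fun y => (-1 : ℝ) ^ 0 * iteratedDeriv 0 f y) (Ioi a) := by
      intro a ha
      simpa using hint.mono_set (Ioi_subset_Ioi ha.le)
    exact fun a ha => ⟨h0 a ha, key 0 h0⟩
  | succ n ih =>
    have h0 : ∀ a, 0 < a →
        IntegrableOn (fun y => (-1 : ℝ) ^ (n + 1) * iteratedDeriv (n + 1) f y) (Ioi a) := by
      intro a ha
      have := integrableOn_Ioi_deriv_of_nonpos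
        (hf.hasDerivAt_signed n ha).continuousAt.continuousWithinAt
        (fun x hx => hf.hasDerivAt_signed n (ha.trans hx))
        (fun x hx => by linarith [hf.2 (n + 1) x (ha.trans hx)]) (ih a ha).2
      simpa using this.neg
    exact fun a ha => ⟨h0 a ha, key (n + 1) h0⟩

theorem lintegral_signed_succ (hf : CompletelyMonotone f) (hint : IntegrableOn f (Ioi 0)) (n : ℕ)
    {a : ℝ} (ha : 0 < a) :
    ∫⁻ y in Ioi a, ENNReal.ofReal ((-1 : ℝ) ^ (n + 1) * iteratedDeriv (n + 1) f y) =
      ENNReal.ofReal ((-1 : ℝ) ^ n * iteratedDeriv n f a) := by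
  have h := integral_Ioi_of_hasDerivAt_of_nonpos
        (hf.hasDerivAt_signed n ha).continuousAt.continuousWithinAt
        (fun x hx => hf.hasDerivAt_signed n (ha.trans hx))
        (fun x hx => by linarith [hf.2 (n + 1) x (ha.trans hx)])
        (hf.integrableOn_signed hint n a ha).2
  rw [integral_neg] at h
  rw [← ofReal_integral_eq_lintegral_ofReal (hf.integrableOn_signed hint (n + 1) a ha).1]
  · congr 1
    linarith
  · filter_upwards [ae_restrict_mem measurableSet_Ioi] with x hx
    exact hf.2 _ x (ha.trans hx)

end CompletelyMonotone

/-- Iterating the tail integral: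
`∫_x^∞ ∫_y^∞ (t-y)^n/n! φ(t) dt dy = ∫_x^∞ (t-x)^(n+1)/(n+1)! φ(t) dt`. -/
theorem lintegral_Ioi_lintegral_Ioi_pow {φ : ℝ → ℝ≥0∞} (hφ : Measurable φ) (n : ℕ) (x : ℝ) :
    ∫⁻ y in Ioi x, ∫⁻ t in Ioi y, ENNReal.ofReal ((t - y) ^ n / n.factorial) * φ t =
      ∫⁻ t in Ioi x, ENNReal.ofReal ((t - x) ^ (n + 1) / (n + 1).factorial) * φ t := by
  -- After Tonelli the inner integral is over y in (x,t) with t fixed.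
  have hinner : ∀ t, x < t → ∫⁻ y in Ioo x t, ENNReal.ofReal ((t - y) ^ n / n.factorial) =
      ENNReal.ofReal ((t - x) ^ (n + 1) / (n + 1).factorial) := by
    intro t ht
    have hcont : Continuous fun y : ℝ => (t - y) ^ n / (n.factorial : ℝ) := by fun_prop
    rw [← ofReal_integral_eq_lintegral_ofReal]
    · congr 1
      rw [← integral_Ioc_eq_integral_Ioo, ← intervalIntegral.integral_of_le ht.le,
        intervalIntegral.integral_div,
        intervalIntegral.integral_comp_sub_left (fun y => y ^ n) t, integral_pow,
        Nat.factorial_succ]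
      push_cast
      simp
      field_simp
    · exact (hcont.integrableOn_Icc (a := x) (b := t)).mono_set Ioo_subset_Icc_self
    · filter_upwards [ae_restrict_mem measurableSet_Ioo] with y hy
      have : 0 ≤ t - y := by linarith [hy.2]
      positivity
  calc ∫⁻ y in Ioi x, ∫⁻ t in Ioi y, ENNReal.ofReal ((t - y) ^ n / n.factorial) * φ t
      = ∫⁻ y, ∫⁻ t, (if x < y ∧ y < t then
          ENNReal.ofReal ((t - y) ^ n / n.factorial) * φ t else 0) := by
        rw [← lintegral_indicator measurableSet_Ioi]
        refine lintegral_congr fun y => ?_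
        by_cases hy : x < y
        · rw [indicator_of_mem (show y ∈ Ioi x from hy), ← lintegral_indicator measurableSet_Ioi]
          refine lintegral_congr fun t => ?_
          simp [indicator_apply, hy]
        · rw [indicator_of_notMem (show y ∉ Ioi x from hy)]
          simp [hy]
    _ = ∫⁻ t, ∫⁻ y, (if x < y ∧ y < t then
          ENNReal.ofReal ((t - y) ^ n / n.factorial) * φ t else 0) := by
        refine lintegral_lintegral_swap (Measurable.aemeasurable ?_)
        refine Measurable.ite ?_ (by fun_prop) measurable_const
        exact (measurableSet_lt measurable_const measurable_fst).inter
          (measurableSet_lt measurable_fst measurable_snd)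
    _ = _ := by
        rw [← lintegral_indicator measurableSet_Ioi]
        refine lintegral_congr fun t => ?_
        by_cases ht : x < t
        · rw [indicator_of_mem (show t ∈ Ioi x from ht), ← hinner t ht,
            ← lintegral_mul_const _ (by fun_prop), ← lintegral_indicator measurableSet_Ioo]
          refine lintegral_congr fun y => ?_
          simp [indicator_apply]
        · rw [indicator_of_notMem (show t ∉ Ioi x from ht)]
          have : ∀ y, ¬ (x < y ∧ y < t) := fun y hy => ht (hy.1.trans hy.2)
          simp [this]

/-- This is Taylor's formula based at infinity: all boundary terms vanish and the remainder is a
nonnegative integral. It serves as a finite-order substitute for Bernstein's representation. -/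
theorem CompletelyMonotone.eq_lintegral_pow {f : ℝ → ℝ} (hf : CompletelyMonotone f)
    (hint : IntegrableOn f (Ioi 0)) (n : ℕ) : ∀ (j : ℕ) {x : ℝ}, 0 < x →
    ENNReal.ofReal ((-1 : ℝ) ^ j * iteratedDeriv j f x) =
      ∫⁻ t in Ioi x, ENNReal.ofReal ((t - x) ^ n / n.factorial) *
        ENNReal.ofReal ((-1 : ℝ) ^ (j + n + 1) * iteratedDeriv (j + n + 1) f t) := by
  induction n with
  | zero =>
    intro j x hx
    simpa using (hf.lintegral_signed_succ hint j hx).symm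
  | succ n ih =>
    intro j x hx
    have hm : Measurable (fun t =>
        ENNReal.ofReal ((-1 : ℝ) ^ (j + (n + 1) + 1) * iteratedDeriv (j + (n + 1) + 1) f t)) := by
      rw [iteratedDeriv_succ]
      have := measurable_deriv (iteratedDeriv (j + (n + 1)) f)
      fun_prop
    rw [← lintegral_Ioi_lintegral_Ioi_pow hm, ← hf.lintegral_signed_succ hint j hx]
    refine setLIntegral_congr_fun measurableSet_Ioi fun y hy => ?_
    rw [ih (j + 1) (hx.trans hy)]
    have : j + 1 + n + 1 = j + (n + 1) + 1 := by ring
    simp only [this]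

/-- The iterated tail of a completely monotone density is log-convex. -/
theorem CompletelyMonotone.sq_tail_le {f : ℝ → ℝ} (hf : CompletelyMonotone f)
    (hint : IntegrableOn f (Ioi 0)) {x : ℝ} (hx : 0 < x) :
    (∫⁻ y in Ioi x, ENNReal.ofReal (f y)) ^ 2 ≤
      ENNReal.ofReal (f x) * ∫⁻ y in Ioi x, ∫⁻ t in Ioi y, ENNReal.ofReal (f t) := by
  set S := ∫⁻ y in Ioi x, ENNReal.ofReal (f y) with hS
  set W := ∫⁻ y in Ioi x, ∫⁻ t in Ioi y, ENNReal.ofReal (f t) with hW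
  -- For each n, the quantities f(x), S and W are the integrals of (t-x)^k/k! for k = n, n+1, n+2
  -- against one weight φ. Cauchy-Schwarz bounds the middle one by the outer two, with a factor that
  -- tends to 1 as n grows.
  have key : ∀ n : ℕ, S ^ 2 ≤ ENNReal.ofReal (1 + 1 / ((n : ℝ) + 1)) * (ENNReal.ofReal (f x) * W) := by
    intro n
    set φ := fun t => ENNReal.ofReal ((-1 : ℝ) ^ (0 + n + 1) * iteratedDeriv (0 + n + 1) f t)
    have hm : Measurable φ := by
      have := measurable_deriv (iteratedDeriv (0 + n) f)
      simp only [φ, iteratedDeriv_succ]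
      fun_prop
    have e0 : ∀ {x : ℝ}, 0 < x → ENNReal.ofReal (f x) =
        ∫⁻ t in Ioi x, ENNReal.ofReal ((t - x) ^ n / n.factorial) * φ t := by
      intro x hx
      simpa [φ] using hf.eq_lintegral_pow hint n 0 hx
    have e1 : ∀ {x : ℝ}, 0 < x → ∫⁻ y in Ioi x, ENNReal.ofReal (f y) =
        ∫⁻ t in Ioi x, ENNReal.ofReal ((t - x) ^ (n + 1) / (n + 1).factorial) * φ t := by
      intro x hx
      rw [← lintegral_Ioi_lintegral_Ioi_pow hm]
      exact setLIntegral_congr_fun measurableSet_Ioi fun y hy => e0 (hx.trans hy)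
    have e2 : W =
        ∫⁻ t in Ioi x, ENNReal.ofReal ((t - x) ^ (n + 2) / (n + 2).factorial) * φ t := by
      rw [hW, ← lintegral_Ioi_lintegral_Ioi_pow hm]
      exact setLIntegral_congr_fun measurableSet_Ioi fun y hy => e1 (hx.trans hy)
    have hCS := ENNReal.lintegral_mul_le_Lp_mul_Lq (volume.restrict (Ioi x))
      Real.HolderConjugate.two_two
      (f := fun t => (ENNReal.ofReal ((t - x) ^ n / n.factorial) * φ t) ^ (1 / 2 : ℝ))
      (g := fun t => (ENNReal.ofReal ((t - x) ^ (n + 2) / (n + 2).factorial) * φ t) ^ (1 / 2 : ℝ))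
      (by fun_prop) (by fun_prop)
    simp only [← ENNReal.rpow_mul, Pi.mul_apply] at hCS
    norm_num only [ENNReal.rpow_one] at hCS
    -- The constant comes from (n+1)!² / (n! (n+2)!) = (n+1)/(n+2).
    have hpt : ∀ t ∈ Ioi x, (ENNReal.ofReal ((t - x) ^ n / n.factorial) * φ t) ^ (1 / 2 : ℝ) *
        (ENNReal.ofReal ((t - x) ^ (n + 2) / (n + 2).factorial) * φ t) ^ (1 / 2 : ℝ) =
        ENNReal.ofReal (Real.sqrt (((n : ℝ) + 1) / (n + 2))) *
          (ENNReal.ofReal ((t - x) ^ (n + 1) / (n + 1).factorial) * φ t) := by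
      intro t ht
      have ht' : 0 < t - x := sub_pos.2 ht
      rw [← ENNReal.mul_rpow_of_nonneg _ _ (by norm_num)]
      have : ENNReal.ofReal ((t - x) ^ n / n.factorial) * φ t *
          (ENNReal.ofReal ((t - x) ^ (n + 2) / (n + 2).factorial) * φ t) =
          (ENNReal.ofReal (Real.sqrt (((n : ℝ) + 1) / (n + 2))) *
          (ENNReal.ofReal ((t - x) ^ (n + 1) / (n + 1).factorial) * φ t)) ^ (2 : ℝ) := by
        rw [ENNReal.rpow_two]
        have : ENNReal.ofReal ((t - x) ^ n / n.factorial) *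
            ENNReal.ofReal ((t - x) ^ (n + 2) / (n + 2).factorial) =
            (ENNReal.ofReal (Real.sqrt (((n : ℝ) + 1) / (n + 2))) *
            ENNReal.ofReal ((t - x) ^ (n + 1) / (n + 1).factorial)) ^ 2 := by
          rw [← ENNReal.ofReal_mul (by positivity), ← ENNReal.ofReal_mul (by positivity),
            ← ENNReal.ofReal_pow (by positivity), mul_pow, Real.sq_sqrt (by positivity)]
          congr 1
          rw [Nat.factorial_succ (n + 1), Nat.factorial_succ n]
          push_cast
          field_simp
          ring
        calc _ = (ENNReal.ofReal ((t - x) ^ n / n.factorial) *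
            ENNReal.ofReal ((t - x) ^ (n + 2) / (n + 2).factorial)) * (φ t) ^ 2 := by ring
          _ = _ := by rw [this]; ring
      rw [this, ← ENNReal.rpow_mul]
      norm_num
    rw [setLIntegral_congr_fun measurableSet_Ioi hpt, lintegral_const_mul _ (by fun_prop),
      ← e1 hx, ← e0 hx, ← e2, ← hS] at hCS
    have h2 := pow_le_pow_left' hCS 2
    have hsq : ∀ a : ℝ≥0∞, (a ^ (1 / 2 : ℝ)) ^ 2 = a := by
      intro a
      rw [← ENNReal.rpow_natCast, ← ENNReal.rpow_mul]
      norm_num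
    rw [mul_pow, mul_pow, hsq, hsq, ← ENNReal.ofReal_pow (by positivity),
      Real.sq_sqrt (by positivity)] at h2
    calc S ^ 2 = ENNReal.ofReal (1 + 1 / ((n : ℝ) + 1)) *
          (ENNReal.ofReal (((n : ℝ) + 1) / (n + 2)) * S ^ 2) := by
          rw [← mul_assoc, ← ENNReal.ofReal_mul (by positivity)]
          have : (1 + 1 / ((n : ℝ) + 1)) * (((n : ℝ) + 1) / (n + 2)) = 1 := by
            field_simp
            ring
          rw [this]
          simp
      _ ≤ _ := by gcongr
  by_cases htop : ENNReal.ofReal (f x) * W = ∞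
  · rw [htop]; exact le_top
  have hlim : Tendsto (fun n : ℕ =>
      ENNReal.ofReal (1 + 1 / ((n : ℝ) + 1)) * (ENNReal.ofReal (f x) * W)) atTop
      (𝓝 (ENNReal.ofReal (1 + 0) * (ENNReal.ofReal (f x) * W))) := by
    refine ENNReal.Tendsto.mul_const ?_ (Or.inr htop)
    exact (ENNReal.continuous_ofReal.tendsto _).comp
      (tendsto_const_nhds.add tendsto_one_div_add_atTop_nhds_zero_nat)
  simpa using ge_of_tendsto' hlim key

/-! ### Convolution of a function with a measure -/

/-- The convolution of a nonnegative function with a measure. -/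
noncomputable def convMeasure (φ : ℝ → ℝ≥0∞) (μ : Measure ℝ) (x : ℝ) : ℝ≥0∞ := ∫⁻ y, φ (x - y) ∂μ

theorem measurable_convMeasure {φ : ℝ → ℝ≥0∞} (hφ : Measurable φ) (μ : Measure ℝ) [SFinite μ] :
    Measurable (convMeasure φ μ) := by
  unfold convMeasure
  exact Measurable.lintegral_prod_right' (f := fun z : ℝ × ℝ => φ (z.1 - z.2)) (by fun_prop)

theorem convMeasure_conv {φ : ℝ → ℝ≥0∞} (hφ : Measurable φ) (μ ν : Measure ℝ) [SFinite μ]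
    [SFinite ν] (x : ℝ) :
    convMeasure φ (μ ∗ ν) x = convMeasure (convMeasure φ μ) ν x := by
  unfold convMeasure
  rw [Measure.conv_comm, Measure.lintegral_conv (by fun_prop)]
  simp only [sub_sub]

theorem convMeasure_add_left {φ ψ : ℝ → ℝ≥0∞} (hφ : Measurable φ) (μ : Measure ℝ) (x : ℝ) :
    convMeasure (fun y => φ y + ψ y) μ x = convMeasure φ μ x + convMeasure ψ μ x := by
  unfold convMeasure
  exact lintegral_add_left (by fun_prop) _

theorem convMeasure_const_mul {φ : ℝ → ℝ≥0∞} (hφ : Measurable φ) (a : ℝ≥0∞) (μ : Measure ℝ)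
    (x : ℝ) : convMeasure (fun y => a * φ y) μ x = a * convMeasure φ μ x := by
  unfold convMeasure
  exact lintegral_const_mul _ (by fun_prop)

theorem convMeasure_smul_dirac_add {φ : ℝ → ℝ≥0∞} (hφ : Measurable φ) (a : ℝ≥0∞) (μ : Measure ℝ)
    (x : ℝ) : convMeasure φ (a • Measure.dirac 0 + μ) x = a * φ x + convMeasure φ μ x := by
  unfold convMeasure
  rw [lintegral_add_measure, lintegral_smul_measure, lintegral_dirac' _ (by fun_prop)]
  simp

theorem convMeasure_withDensity {φ ψ : ℝ → ℝ≥0∞} (hφ : Measurable φ) (hψ : Measurable ψ) (x : ℝ) :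
    convMeasure φ (volume.withDensity ψ) x = ∫⁻ y, φ (x - y) * ψ y := by
  unfold convMeasure
  rw [lintegral_withDensity_eq_lintegral_mul _ hψ (by fun_prop)]
  simp only [Pi.mul_apply, mul_comm]

theorem convMeasure_withDensity_comm {φ ψ : ℝ → ℝ≥0∞} (hφ : Measurable φ) (hψ : Measurable ψ)
    (x : ℝ) :
    convMeasure φ (volume.withDensity ψ) x = convMeasure ψ (volume.withDensity φ) x := by
  rw [convMeasure_withDensity hφ hψ, convMeasure_withDensity hψ hφ,
    ← lintegral_sub_left_eq_self _ x]
  simp only [sub_sub_cancel, mul_comm]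

theorem withDensity_conv {φ : ℝ → ℝ≥0∞} (hφ : Measurable φ) (m : Measure ℝ) [SFinite m] :
    (volume.withDensity φ) ∗ m = volume.withDensity (convMeasure φ m) := by
  ext s hs
  rw [withDensity_apply _ hs, ← lintegral_indicator_one hs, Measure.conv_comm,
    Measure.lintegral_conv (measurable_one.indicator hs), ← lintegral_indicator hs]
  have : ∀ y x : ℝ, s.indicator (convMeasure φ m) x = ∫⁻ y, s.indicator 1 x * φ (x - y) ∂m := by
    intro y x
    rw [lintegral_const_mul _ (by fun_prop)]
    by_cases hx : x ∈ s <;> simp [hx, convMeasure]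
  have hm1 : Measurable (s.indicator (1 : ℝ → ℝ≥0∞)) := measurable_one.indicator hs
  simp_rw [this 0]
  conv_rhs => rw [lintegral_lintegral_swap (by fun_prop)]
  refine lintegral_congr fun y => ?_
  rw [lintegral_withDensity_eq_lintegral_mul _ hφ (by fun_prop)]
  conv_rhs => rw [← lintegral_add_left_eq_self _ y]
  simp only [Pi.mul_apply, add_sub_cancel_left, mul_comm]

theorem convMeasure_eq_zero {φ : ℝ → ℝ≥0∞} (h0 : ∀ x ≤ 0, φ x = 0) {m : Measure ℝ}
    (hm : m (Iio 0) = 0) {x : ℝ} (hx : x ≤ 0) : convMeasure φ m x = 0 := by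
  unfold convMeasure
  rw [lintegral_eq_zero_of_ae_eq_zero]
  have : ∀ᵐ y ∂m, y ∉ Iio 0 := measure_eq_zero_iff_ae_notMem.1 hm
  filter_upwards [this] with y hy
  exact h0 _ (by simp at hy; linarith)

theorem convMeasure_indicator_one {ψ : ℝ → ℝ≥0∞} (hψ : Measurable ψ) (x : ℝ) :
    convMeasure ((Ioi 0).indicator 1) (volume.withDensity ψ) x = ∫⁻ y in Iio x, ψ y := by
  rw [convMeasure_withDensity (measurable_one.indicator measurableSet_Ioi) hψ,
    ← lintegral_indicator measurableSet_Iio]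
  refine lintegral_congr fun y => ?_
  simp [indicator_apply]

/-! ### Defective renewal equations with decreasing hazard rate -/

/-- A Grönwall inequality for integrable nonnegative functions. -/
theorem eq_zero_of_le_mul_setLIntegral_Iio {n : ℝ → ℝ≥0∞} (hn : Measurable n) (hfin : ∫⁻ x, n x ≠ ∞)
    (h0 : ∀ x ≤ 0, n x = 0) {K : ℝ} (hK : 0 < K)
    (h : ∀ x, n x ≤ ENNReal.ofReal K * ∫⁻ s in Iio x, n s) (x : ℝ) : n x = 0 := by
  -- The rate 2K makes K ∫_s^∞ w = w(s)/2, so integrating the hypothesis against w gives I ≤ I/2; as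
  -- I is finite, it vanishes.
  set w : ℝ → ℝ≥0∞ := fun x => ENNReal.ofReal (Real.exp (-(2 * K) * x)) with hw
  have hwm : Measurable w := by fun_prop
  set I := ∫⁻ x, w x * n x with hI
  have hIfin : I ≠ ∞ := by
    refine ne_top_of_le_ne_top hfin (lintegral_mono fun x => ?_)
    rcases le_or_gt x 0 with hx | hx
    · simp [h0 x hx]
    · have : w x ≤ 1 := by
        simp only [w, ENNReal.ofReal_le_one, Real.exp_le_one_iff]
        nlinarith
      calc w x * n x ≤ 1 * n x := by gcongr
        _ = n x := one_mul _
  have htail : ∀ s, ENNReal.ofReal K * ∫⁻ x in Ioi s, w x = ENNReal.ofReal (1 / 2) * w s := by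
    intro s
    have hint := integrableOn_exp_mul_Ioi (show -(2 * K) < 0 by linarith) s
    simp only [w]
    rw [← ofReal_integral_eq_lintegral_ofReal hint (ae_of_all _ fun x => (Real.exp_pos _).le),
      integral_exp_mul_Ioi (by linarith), ← ENNReal.ofReal_mul hK.le,
      ← ENNReal.ofReal_mul (by norm_num)]
    congr 1
    field_simp
  have hle : I ≤ ENNReal.ofReal (1 / 2) * I := by
    calc I ≤ ∫⁻ x, w x * (ENNReal.ofReal K * ∫⁻ s in Iio x, n s) :=
          lintegral_mono fun x => by gcongr; exact h x
      _ = ∫⁻ x, ∫⁻ s, (if s < x then ENNReal.ofReal K * w x * n s else 0) := by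
          refine lintegral_congr fun x => ?_
          rw [← mul_assoc, mul_comm (w x), ← lintegral_const_mul _ hn,
            ← lintegral_indicator measurableSet_Iio]
          exact lintegral_congr fun s => by simp [indicator_apply]
      _ = ∫⁻ s, ∫⁻ x, (if s < x then ENNReal.ofReal K * w x * n s else 0) := by
          refine lintegral_lintegral_swap (Measurable.aemeasurable ?_)
          exact Measurable.ite (measurableSet_lt measurable_snd measurable_fst) (by fun_prop)
            measurable_const
      _ = ∫⁻ s, ENNReal.ofReal (1 / 2) * (w s * n s) := by
          refine lintegral_congr fun s => ?_
          rw [← mul_assoc, ← htail, ← lintegral_const_mul _ hwm, ← lintegral_mul_const _ (by fun_prop),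
            ← lintegral_indicator measurableSet_Ioi]
          exact lintegral_congr fun x => by simp [indicator_apply]
      _ = _ := by rw [lintegral_const_mul _ (by fun_prop)]
  have hI0 : I = 0 := by
    by_contra hne
    have h1 : ENNReal.ofReal (1 / 2) * I < I := by
      calc ENNReal.ofReal (1 / 2) * I < 1 * I :=
            ENNReal.mul_lt_mul_left hne hIfin (by rw [ENNReal.ofReal_lt_one]; norm_num)
        _ = I := one_mul _
    exact absurd hle (not_le.2 h1)
  have hae : n =ᵐ[volume] 0 := by
    have := (lintegral_eq_zero_iff (by fun_prop : Measurable fun x => w x * n x)).1 hI0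
    filter_upwards [this] with y hy
    have hwy : w y ≠ 0 := by simp [w, Real.exp_pos]
    simpa [hwy] using hy
  have h2 : ∫⁻ s in Iio x, n s = 0 := by
    rw [lintegral_eq_zero_iff hn]
    exact ae_restrict_of_ae hae
  have := h x
  rw [h2, mul_zero] at this
  exact le_zero_iff.1 this

/-- The data of a defective renewal equation `m = c δ₀ + Γ ∗ m`, where `Γ` has a density `G` which
is the tail of `b`, and whose (defective) survival function `T` has a decreasing hazard rate `r`. -/
structure DFRRenewal (b G T r : ℝ → ℝ≥0∞) (c : ℝ≥0∞) (K : ℝ) (m : Measure ℝ) : Prop where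
  pos : 0 < K
  hc : c ≠ ∞
  measurable_b : Measurable b
  measurable_G : Measurable G
  measurable_T : Measurable T
  b_zero : ∀ x ≤ 0, b x = 0
  G_zero : ∀ x ≤ 0, G x = 0
  b_fin : ∀ x, b x ≠ ∞
  r_fin : ∀ x, 0 < x → r x ≠ ∞
  lintegral_b : ∫⁻ x, b x ≠ ∞
  tail_b : ∀ x, G x + convMeasure ((Ioi 0).indicator 1) (volume.withDensity b) x =
    ENNReal.ofReal K * (Ioi (0 : ℝ)).indicator 1 x
  tail_G : ∀ x, T x + convMeasure ((Ioi 0).indicator 1) (volume.withDensity G) x =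
    (Ioi (0 : ℝ)).indicator 1 x
  hazard : ∀ x, 0 < x → G x = r x * T x
  hazard_anti : ∀ x y, 0 < x → x ≤ y → r y ≤ r x
  hazard_le : ∀ x, 0 < x → r x * G x ≤ b x
  prob : IsProbabilityMeasure m
  m_neg : m (Iio 0) = 0
  eqn : m = c • Measure.dirac 0 + (volume.withDensity G) ∗ m

namespace DFRRenewal

variable {b G T r : ℝ → ℝ≥0∞} {c : ℝ≥0∞} {K : ℝ} {m : Measure ℝ}

theorem G_le (h : DFRRenewal b G T r c K m) (x : ℝ) : G x ≤ ENNReal.ofReal K :=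
  calc G x ≤ G x + convMeasure ((Ioi 0).indicator 1) (volume.withDensity b) x := le_self_add
    _ ≤ _ := by
      rw [h.tail_b]
      by_cases hx : 0 < x <;> simp [hx]

theorem conv_G_le (h : DFRRenewal b G T r c K m) (x : ℝ) : convMeasure G m x ≤ ENNReal.ofReal K := by
  have := h.prob
  calc convMeasure G m x ≤ ∫⁻ y, ENNReal.ofReal K ∂m := lintegral_mono fun y => h.G_le _
    _ = _ := by simp

theorem measurable_conv_G (h : DFRRenewal b G T r c K m) : Measurable (convMeasure G m) := by
  have := h.prob
  exact measurable_convMeasure h.measurable_G m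

theorem measurable_conv_b (h : DFRRenewal b G T r c K m) : Measurable (convMeasure b m) := by
  have := h.prob
  exact measurable_convMeasure h.measurable_b m

theorem eqn' (h : DFRRenewal b G T r c K m) :
    m = c • Measure.dirac 0 + volume.withDensity (convMeasure G m) := by
  have := h.prob
  conv_lhs => rw [h.eqn]
  rw [withDensity_conv h.measurable_G]

theorem conv_G_eq (h : DFRRenewal b G T r c K m) (x : ℝ) :
    convMeasure G m x = c * G x + convMeasure G (volume.withDensity (convMeasure G m)) x := by
  conv_lhs => rw [h.eqn']
  rw [convMeasure_smul_dirac_add h.measurable_G]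

theorem conv_b_eq (h : DFRRenewal b G T r c K m) (x : ℝ) :
    convMeasure b m x = c * b x + convMeasure b (volume.withDensity (convMeasure G m)) x := by
  conv_lhs => rw [h.eqn']
  rw [convMeasure_smul_dirac_add h.measurable_b]

/-- The term b ∗ Γ ∗ m is regrouped as G against b ∗ m, so that p = b ∗ m solves a renewal equation
with the same kernel G as u = G ∗ m. -/
theorem conv_b_eq' (h : DFRRenewal b G T r c K m) (x : ℝ) :
    convMeasure b m x = c * b x + convMeasure G (volume.withDensity (convMeasure b m)) x := by
  have := h.prob
  rw [h.conv_b_eq, ← withDensity_conv h.measurable_G, ← withDensity_conv h.measurable_b,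
    convMeasure_conv h.measurable_b, convMeasure_conv h.measurable_G]
  congr 2
  funext y
  exact convMeasure_withDensity_comm h.measurable_b h.measurable_G y

/-- b may be unbounded near 0, but it is integrable, and apart from its atom m has density G ∗ m ≤
K. -/
theorem conv_b_fin (h : DFRRenewal b G T r c K m) (x : ℝ) : convMeasure b m x ≠ ∞ := by
  rw [h.conv_b_eq, convMeasure_withDensity h.measurable_b h.measurable_conv_G]
  refine ENNReal.add_ne_top.2 ⟨ENNReal.mul_ne_top h.hc (h.b_fin x), ?_⟩
  refine ne_top_of_le_ne_top (ENNReal.mul_ne_top h.lintegral_b ENNReal.ofReal_ne_top)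
    (b := (∫⁻ y, b y) * ENNReal.ofReal K) ?_
  calc ∫⁻ y, b (x - y) * convMeasure G m y ≤ ∫⁻ y, b (x - y) * ENNReal.ofReal K :=
        lintegral_mono fun y => by gcongr; exact h.conv_G_le y
    _ = _ := by
        have := h.measurable_b
        rw [lintegral_mul_const _ (by fun_prop), lintegral_sub_left_eq_self]

theorem lintegral_conv_b (h : DFRRenewal b G T r c K m) :
    ∫⁻ x, convMeasure b m x = ∫⁻ x, b x := by
  have := h.prob
  have e := congrArg (fun μ : Measure ℝ => μ univ) (withDensity_conv h.measurable_b m)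
  simp only [withDensity_apply _ MeasurableSet.univ, Measure.restrict_univ] at e
  rw [← e, ← lintegral_one, Measure.lintegral_conv measurable_const]
  simp

theorem lintegral_conv_G_le (h : DFRRenewal b G T r c K m) :
    ∫⁻ x, convMeasure G m x ≤ 1 := by
  have := h.prob
  have e := congrArg (fun μ : Measure ℝ => μ univ) h.eqn'
  simp only [Measure.add_apply, withDensity_apply _ MeasurableSet.univ, Measure.restrict_univ,
    measure_univ] at e
  rw [e]
  exact le_add_self

theorem measurable_H : Measurable ((Ioi (0 : ℝ)).indicator (1 : ℝ → ℝ≥0∞)) :=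
  measurable_one.indicator measurableSet_Ioi

/-- With H the indicator of (0,∞), T = H - H ∗ Γ and m - Γ ∗ m = c δ₀, so T ∗ m = H ∗ (m - Γ ∗ m) =
c H. The subtraction is a cancellation of a finite term. -/
theorem conv_T (h : DFRRenewal b G T r c K m) (x : ℝ) :
    convMeasure T m x = c * (Ioi (0 : ℝ)).indicator 1 x := by
  have := h.prob
  have hΓ : SFinite (volume.withDensity G) := inferInstance
  set A := convMeasure (convMeasure ((Ioi 0).indicator 1) (volume.withDensity G)) m x
  have e1 : convMeasure ((Ioi 0).indicator 1) m x = c * (Ioi (0 : ℝ)).indicator 1 x + A := by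
    conv_lhs => rw [h.eqn]
    rw [convMeasure_smul_dirac_add measurable_H, convMeasure_conv measurable_H]
  have e2 : convMeasure ((Ioi 0).indicator 1) m x = convMeasure T m x + A := by
    rw [← convMeasure_add_left h.measurable_T]
    congr 1
    funext y
    exact (h.tail_G y).symm
  have hfin : convMeasure ((Ioi 0).indicator 1) m x ≠ ∞ := by
    refine ne_top_of_le_ne_top ENNReal.one_ne_top ?_
    calc convMeasure ((Ioi 0).indicator 1) m x ≤ ∫⁻ y, 1 ∂m :=
          lintegral_mono fun y => indicator_le_self' (by simp) _
      _ = 1 := by simp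
  have hA : A ≠ ∞ := ne_top_of_le_ne_top hfin (by rw [e2]; exact le_add_self)
  exact (ENNReal.add_left_inj hA).1 (e2.symm.trans e1)

/-- Commuting convolutions, T ∗ (b ∗ m) = b ∗ (T ∗ m) = c (b ∗ H), and G is the complementary tail
of b. -/
theorem conv_T_conv_b (h : DFRRenewal b G T r c K m) {x : ℝ} (hx : 0 < x) :
    c * G x + convMeasure T (volume.withDensity (convMeasure b m)) x = c * ENNReal.ofReal K := by
  have := h.prob
  rw [← withDensity_conv h.measurable_b, Measure.conv_comm, convMeasure_conv h.measurable_T,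
    show convMeasure T m = _ from funext h.conv_T, convMeasure_const_mul measurable_H, ← mul_add,
    h.tail_b]
  simp [hx]

theorem conv_T_conv_G (h : DFRRenewal b G T r c K m) {x : ℝ} (hx : 0 < x) :
    c * T x + convMeasure T (volume.withDensity (convMeasure G m)) x = c := by
  have := h.prob
  rw [← withDensity_conv h.measurable_G, Measure.conv_comm, convMeasure_conv h.measurable_T,
    show convMeasure T m = _ from funext h.conv_T, convMeasure_const_mul measurable_H, ← mul_add,
    h.tail_G]
  simp [hx]

theorem T_zero (h : DFRRenewal b G T r c K m) {x : ℝ} (hx : x ≤ 0) : T x = 0 := by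
  have := h.tail_G x
  simp [not_lt.2 hx] at this
  exact this.1

/-- Decomposition of the convolution with `G` by comparing hazard rates. -/
theorem conv_G_withDensity (h : DFRRenewal b G T r c K m) {q : ℝ → ℝ≥0∞} (hq : Measurable q)
    (hq0 : ∀ x ≤ 0, q x = 0) (x : ℝ) :
    convMeasure G (volume.withDensity q) x =
      (∫⁻ s, (G (x - s) - r x * T (x - s)) * q s) + r x * convMeasure T (volume.withDensity q) x := by
  have hT := h.measurable_T
  have hG := h.measurable_G
  rw [convMeasure_withDensity hG hq, convMeasure_withDensity hT hq,
    ← lintegral_const_mul _ (by fun_prop), ← lintegral_add_right _ (by fun_prop)]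
  refine lintegral_congr fun s => ?_
  rcases le_or_gt s 0 with hs | hs
  · simp [hq0 s hs]
  -- The truncated subtraction is exact: for 0 < s < x, G(x-s) = r(x-s) T(x-s) ≥ r(x) T(x-s), as r
  -- decreases.
  · rw [← mul_assoc, ← add_mul, tsub_add_cancel_of_le]
    rcases le_or_gt x s with hxs | hxs
    · simp [h.T_zero (show x - s ≤ 0 by linarith)]
    · rw [h.hazard (x - s) (by linarith)]
      gcongr
      exact h.hazard_anti _ _ (by linarith) (by linarith)

/-- Write u = G ∗ m, p = b ∗ m and k(x,s) = G(x-s) - r(x) T(x-s). The renewal equations and the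
identities for T give u = ∫ k u + r c and, using r G ≤ b, also p ≥ ∫ k p + K r c. So the positive
part n of K u - p satisfies n ≤ ∫ k n ≤ K ∫_{s<x} n, and Grönwall forces n = 0. -/
theorem conv_G_le_conv_b (h : DFRRenewal b G T r c K m) (x : ℝ) :
    ENNReal.ofReal K * convMeasure G m x ≤ convMeasure b m x := by
  have hT := h.measurable_T
  have hG := h.measurable_G
  have hpm := h.measurable_conv_b
  have hum := h.measurable_conv_G
  set p := convMeasure b m
  set u := convMeasure G m
  set k : ℝ → ℝ → ℝ≥0∞ := fun x s => G (x - s) - r x * T (x - s)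
  have hkm : ∀ x, Measurable (k x) := fun x => by simp only [k]; fun_prop
  -- Truncated subtraction in `ℝ≥0∞` produces the positive part directly.
  set n : ℝ → ℝ≥0∞ := fun x => ENNReal.ofReal K * u x - p x
  have hnm : Measurable n := by fun_prop
  have hp0 : ∀ x ≤ 0, p x = 0 := fun x hx => convMeasure_eq_zero h.b_zero h.m_neg hx
  have hu0 : ∀ x ≤ 0, u x = 0 := fun x hx => convMeasure_eq_zero h.G_zero h.m_neg hx
  have hp : ∀ x, 0 < x → (∫⁻ s, k x s * p s) + r x * (c * ENNReal.ofReal K) ≤ p x := by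
    intro x hx
    have hfin : r x * (c * G x) ≠ ∞ := ENNReal.mul_ne_top (h.r_fin x hx)
      (ENNReal.mul_ne_top h.hc (ne_top_of_le_ne_top ENNReal.ofReal_ne_top (h.G_le x)))
    refine (ENNReal.add_le_add_iff_right hfin).1 ?_
    calc (∫⁻ s, k x s * p s) + r x * (c * ENNReal.ofReal K) + r x * (c * G x)
        = c * (r x * G x) + ((∫⁻ s, k x s * p s) + r x * (c * ENNReal.ofReal K)) := by ring
      _ ≤ c * b x + ((∫⁻ s, k x s * p s) + r x * (c * ENNReal.ofReal K)) := by
          gcongr; exact h.hazard_le x hx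
      _ = p x + r x * (c * G x) := by
          rw [← h.conv_T_conv_b hx, show p x = _ from h.conv_b_eq' x,
            h.conv_G_withDensity hpm hp0 x]
          ring
  have hu : ∀ x, 0 < x → u x = (∫⁻ s, k x s * u s) + r x * c := by
    intro x hx
    conv_lhs => rw [show u x = _ from h.conv_G_eq x, h.conv_G_withDensity hum hu0 x]
    conv_rhs => rw [← h.conv_T_conv_G hx]
    conv_lhs => rw [h.hazard x hx]
    ring
  have hn : ∀ x, n x ≤ ENNReal.ofReal K * ∫⁻ s in Iio x, n s := by
    intro x
    rcases le_or_gt x 0 with hx | hx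
    · simp [n, hu0 x hx]
    have h1 : ENNReal.ofReal K * u x ≤ p x + ∫⁻ s, k x s * n s := by
      calc ENNReal.ofReal K * u x
          = (∫⁻ s, k x s * (ENNReal.ofReal K * u s)) + r x * (c * ENNReal.ofReal K) := by
            rw [hu x hx, mul_add, ← lintegral_const_mul _ (by fun_prop)]
            congr 1
            · exact lintegral_congr fun s => by ring
            · ring
        _ ≤ (∫⁻ s, (k x s * p s + k x s * n s)) + r x * (c * ENNReal.ofReal K) := by
            gcongr with s
            rw [← mul_add]
            gcongr
            exact le_add_tsub
        _ = ((∫⁻ s, k x s * p s) + r x * (c * ENNReal.ofReal K)) + ∫⁻ s, k x s * n s := by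
            rw [lintegral_add_left (by fun_prop)]
            ring
        _ ≤ _ := by gcongr; exact hp x hx
    calc n x ≤ ∫⁻ s, k x s * n s := tsub_le_iff_left.2 h1
      _ ≤ ∫⁻ s, (Iio x).indicator (fun s => ENNReal.ofReal K * n s) s := by
          refine lintegral_mono fun s => ?_
          by_cases hs : s < x
          · simp only [indicator_of_mem (show s ∈ Iio x from hs)]
            gcongr
            exact tsub_le_self.trans (h.G_le _)
          · simp [k, h.G_zero (x - s) (by linarith)]
      _ = _ := by rw [lintegral_indicator measurableSet_Iio, lintegral_const_mul _ hnm]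
  have hnfin : ∫⁻ x, n x ≠ ∞ := by
    refine ne_top_of_le_ne_top (b := ENNReal.ofReal K) ENNReal.ofReal_ne_top ?_
    calc ∫⁻ x, n x ≤ ∫⁻ x, ENNReal.ofReal K * u x := lintegral_mono fun x => tsub_le_self
      _ = ENNReal.ofReal K * ∫⁻ x, u x := lintegral_const_mul _ hum
      _ ≤ ENNReal.ofReal K * 1 := by gcongr; exact h.lintegral_conv_G_le
      _ = _ := mul_one _
  have := eq_zero_of_le_mul_setLIntegral_Iio hnm hnfin
    (fun x hx => by simp [n, hu0 x hx]) h.pos hn x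
  exact tsub_eq_zero_iff_le.1 this

/-- Integrated form of u' = K u - p, obtained by convolving the tail relation between G and b with
m. It avoids differentiating u. -/
theorem integrated_eqn (h : DFRRenewal b G T r c K m) {x : ℝ} (hx : 0 < x) :
    (∫⁻ s in Iio x, convMeasure b m s) + convMeasure G m x =
      ENNReal.ofReal K * (c + ∫⁻ s in Iio x, convMeasure G m s) := by
  have := h.prob
  rw [← convMeasure_indicator_one h.measurable_conv_b, ← withDensity_conv h.measurable_b,
    convMeasure_conv measurable_H, add_comm, ← convMeasure_add_left h.measurable_G,
    show (fun y => _) = _ from funext h.tail_b, convMeasure_const_mul measurable_H]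
  congr 1
  conv_lhs => rw [h.eqn']
  rw [convMeasure_smul_dirac_add measurable_H, convMeasure_indicator_one h.measurable_conv_G]
  simp [hx]

/-- Subtract the integrated equations at x and y: the increment of u is the integral over [x,y) of K
u - p, which is nonpositive. -/
theorem conv_G_anti (h : DFRRenewal b G T r c K m) {x y : ℝ} (hx : 0 < x) (hxy : x ≤ y) :
    convMeasure G m y ≤ convMeasure G m x := by
  have hsplit : ∀ q : ℝ → ℝ≥0∞, Measurable q →
      ∫⁻ s in Iio y, q s = (∫⁻ s in Iio x, q s) + ∫⁻ s in Ico x y, q s := by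
    intro q hq
    rw [← lintegral_union measurableSet_Ico, Iio_union_Ico_eq_Iio hxy]
    exact Set.disjoint_left.2 fun s hs hs' => absurd hs.out (not_lt.2 hs'.1)
  have ex := h.integrated_eqn hx
  have ey := h.integrated_eqn (hx.trans_le hxy)
  rw [hsplit _ h.measurable_conv_b, hsplit _ h.measurable_conv_G, ← add_assoc c, mul_add, ← ex] at ey
  have hP : ∫⁻ s in Iio x, convMeasure b m s ≠ ∞ :=
    ne_top_of_le_ne_top h.lintegral_b (h.lintegral_conv_b ▸ setLIntegral_le_lintegral _ _)
  have hQ : ∫⁻ s in Ico x y, convMeasure b m s ≠ ∞ :=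
    ne_top_of_le_ne_top h.lintegral_b (h.lintegral_conv_b ▸ setLIntegral_le_lintegral _ _)
  have hle : ENNReal.ofReal K * ∫⁻ s in Ico x y, convMeasure G m s ≤
      ∫⁻ s in Ico x y, convMeasure b m s := by
    rw [← lintegral_const_mul _ h.measurable_conv_G]
    exact setLIntegral_mono' measurableSet_Ico fun s _ => h.conv_G_le_conv_b s
  refine (ENNReal.add_le_add_iff_left (ENNReal.add_ne_top.2 ⟨hP, hQ⟩)).1 ?_
  rw [ey]
  calc _ ≤ (∫⁻ s in Iio x, convMeasure b m s) + convMeasure G m x +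
        ∫⁻ s in Ico x y, convMeasure b m s := by gcongr
    _ = _ := by ring

end DFRRenewal

/-! ### The excess distribution -/

section Excess

variable {β : Measure ℝ}

theorem ae_pos_of_Iic_zero (h0 : β (Iic 0) = 0) : ∀ᵐ x ∂β, 0 < x := by
  filter_upwards [measure_eq_zero_iff_ae_notMem.1 h0] with x hx
  simpa using hx

theorem lintegral_measure_Ioi (h0 : β (Iic 0) = 0) (hint : Integrable (fun x => x) β) :
    ∫⁻ x in Ioi 0, β (Ioi x) = ENNReal.ofReal (∫ u, u ∂β) := by
  have hpos := ae_pos_of_Iic_zero h0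
  rw [ofReal_integral_eq_lintegral_ofReal hint (hpos.mono fun x hx => hx.le),
    lintegral_eq_lintegral_meas_lt β (hpos.mono fun x hx => hx.le) hint.aemeasurable]
  rfl

variable [IsProbabilityMeasure β]

theorem integral_id_pos (h0 : β (Iic 0) = 0) (hint : Integrable (fun x => x) β) :
    0 < ∫ u, u ∂β := by
  have hpos := ae_pos_of_Iic_zero h0
  rw [integral_pos_iff_support_of_nonneg_ae (hpos.mono fun x hx => hx.le) hint]
  have : β (Function.support fun x : ℝ => x) = β univ :=
    measure_congr (by
      filter_upwards [hpos] with x hx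
      exact propext ⟨fun _ => mem_univ x, fun _ => hx.ne'⟩)
  rw [this]
  simp

theorem measurable_measureReal_Ioi : Measurable fun x => β.real (Ioi x) := by
  have : Antitone fun x => β.real (Ioi x) := fun x y hxy =>
    measureReal_mono (Ioi_subset_Ioi hxy)
  exact this.measurable

theorem isProbabilityMeasure_excessLaw (h0 : β (Iic 0) = 0) (hint : Integrable (fun x => x) β) :
    IsProbabilityMeasure (excessLaw β) := by
  have hE := integral_id_pos h0 hint
  constructor
  rw [excessLaw, measureOfDensity, withDensity_apply _ MeasurableSet.univ, Measure.restrict_univ]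
  have : ∀ x, ENNReal.ofReal (excessDensity β x) =
      β (Ioi x) * (ENNReal.ofReal (∫ u, u ∂β))⁻¹ := by
    intro x
    rw [excessDensity, div_eq_mul_inv, ENNReal.ofReal_mul measureReal_nonneg,
      ENNReal.ofReal_inv_of_pos hE, ofReal_measureReal]
  simp_rw [this]
  rw [lintegral_mul_const' _ _ (by simp [hE]), lintegral_measure_Ioi h0 hint]
  exact ENNReal.mul_inv_cancel (by simp [hE]) ENNReal.ofReal_ne_top

/-- Integration by parts through Fubini: write exp(iθx) - 1 as the integral of iθ exp(iθs) over 0 <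
s < x and integrate over x first, which produces the tail β((s,∞)). -/
theorem charFun_eq_excessLaw (h0 : β (Iic 0) = 0) (hint : Integrable (fun x => x) β) (θ : ℝ) :
    charFun β θ = 1 + θ * Complex.I * (∫ u, u ∂β : ℝ) * charFun (excessLaw β) θ := by
  have hE := integral_id_pos h0 hint
  have hpos := ae_pos_of_Iic_zero h0
  set e : ℝ → ℂ := fun s => θ * Complex.I * Complex.exp (θ * s * Complex.I) with he
  have hem : Continuous e := by fun_prop
  have hen : ∀ s, ‖e s‖ = |θ| := by
    intro s
    have : (θ : ℂ) * s * Complex.I = ((θ * s : ℝ) : ℂ) * Complex.I := by push_cast; ring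
    simp only [e, norm_mul, this, Complex.norm_exp_ofReal_mul_I]
    simp
  set F : ℝ → ℝ → ℂ := fun x s => if 0 < s ∧ s < x then e s else 0 with hF
  have hFm : Measurable (Function.uncurry F) := by
    refine Measurable.ite ?_ (by fun_prop) measurable_const
    exact (measurableSet_lt measurable_const measurable_snd).inter
      (measurableSet_lt measurable_snd measurable_fst)
  have hFi : ∀ x, F x = (Ioo 0 x).indicator e := by
    intro x; funext s; simp [F, indicator_apply]
  have hFn : ∀ x, (fun s => ‖F x s‖) = (Ioo 0 x).indicator fun _ => |θ| := by
    intro x; funext s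
    by_cases h : 0 < s ∧ s < x <;> simp [F, h, hen]
  have hFint : Integrable (Function.uncurry F) (β.prod volume) := by
    rw [integrable_prod_iff hFm.aestronglyMeasurable]
    constructor
    · refine ae_of_all _ fun x => ?_
      change Integrable (F x) volume
      rw [hFi, integrable_indicator_iff measurableSet_Ioo]
      exact (hem.integrableOn_Icc).mono_set Ioo_subset_Icc_self
    · have : ∀ᵐ x ∂β, (∫ s, ‖Function.uncurry F (x, s)‖) = |θ| * x := by
        filter_upwards [hpos] with x hx
        change ∫ s, ‖F x s‖ = _
        rw [hFn, integral_indicator measurableSet_Ioo, setIntegral_const]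
        simp [hx.le, mul_comm]
      exact (hint.const_mul |θ|).congr (this.mono fun x hx => hx.symm)
  have h1 : charFun β θ - 1 = ∫ x, (∫ s, F x s) ∂β := by
    have : (1 : ℂ) = ∫ x, (1 : ℂ) ∂β := by simp
    rw [charFun_apply_real, this, ← integral_sub]
    · refine integral_congr_ae ?_
      filter_upwards [hpos] with x hx
      rw [hFi, integral_indicator measurableSet_Ioo, ← integral_Ioc_eq_integral_Ioo,
        ← intervalIntegral.integral_of_le hx.le]
      have hd : ∀ s ∈ uIcc 0 x, HasDerivAt (fun s : ℝ => Complex.exp (θ * s * Complex.I)) (e s) s := by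
        intro s _
        have h2 : HasDerivAt (fun s : ℝ => (θ : ℂ) * s * Complex.I) (θ * Complex.I) s := by
          have := ((Complex.ofRealCLM.hasDerivAt (x := s)).const_mul (θ : ℂ)).mul_const Complex.I
          simpa using this
        have := h2.cexp
        simp only [e]
        convert this using 1
        ring
      rw [intervalIntegral.integral_eq_sub_of_hasDerivAt hd (hem.intervalIntegrable _ _)]
      simp
    · refine Integrable.of_bound (C := 1) (by fun_prop) (ae_of_all _ fun x => ?_)
      have : (θ : ℂ) * x * Complex.I = ((θ * x : ℝ) : ℂ) * Complex.I := by push_cast; ring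
      rw [this, Complex.norm_exp_ofReal_mul_I]
    · exact integrable_const _
  have h2 : ∫ x, (∫ s, F x s) ∂β = ∫ s in Ioi 0, (β.real (Ioi s) : ℂ) * e s := by
    rw [integral_integral_swap hFint, ← integral_indicator measurableSet_Ioi]
    congr 1
    funext s
    by_cases hs : 0 < s
    · have : (fun x => F x s) = (Ioi s).indicator fun _ => e s := by
        funext x; simp [F, indicator_apply, hs]
      rw [this, integral_indicator measurableSet_Ioi, setIntegral_const,
        indicator_of_mem (show s ∈ Ioi (0 : ℝ) from hs), Complex.real_smul]
    · have : (fun x => F x s) = fun _ => 0 := by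
        funext x; simp [F, hs]
      rw [this, indicator_of_notMem (show s ∉ Ioi (0 : ℝ) from hs)]
      simp
  have h3 : charFun (excessLaw β) θ =
      ∫ s in Ioi 0, (β.real (Ioi s) / (∫ u, u ∂β) : ℝ) * Complex.exp (θ * s * Complex.I) := by
    rw [charFun_apply_real, excessLaw, measureOfDensity, integral_withDensity_eq_integral_toReal_smul]
    · refine setIntegral_congr_fun measurableSet_Ioi fun s _ => ?_
      simp only [excessDensity]
      rw [ENNReal.toReal_ofReal (by positivity), Complex.real_smul]
    · unfold excessDensity
      have := measurable_measureReal_Ioi (β := β)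
      fun_prop
    · exact ae_of_all _ fun _ => ENNReal.ofReal_lt_top
  rw [← sub_eq_iff_eq_add', h3, ← integral_const_mul, h1, h2]
  refine setIntegral_congr_fun measurableSet_Ioi fun s _ => ?_
  have hE' : ((∫ u, u ∂β : ℝ) : ℂ) ≠ 0 := by exact_mod_cast hE.ne'
  simp only [e, Complex.ofReal_div]
  field_simp

end Excess


/-! ### Exponential interarrival times -/

section Kernel

theorem expMeasure_eq {r : ℝ} : expMeasure r = measureOfDensity fun a => r * Real.exp (-(r * a)) := by
  unfold expMeasure gammaMeasure measureOfDensity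
  rw [← withDensity_indicator measurableSet_Ioi]
  refine withDensity_congr_ae ?_
  have : ∀ᵐ x : ℝ, x ≠ 0 := by simp [ae_iff]
  filter_upwards [this] with x hx
  rcases lt_or_gt_of_ne hx with h | h
  · simp [gammaPDF_of_neg h, not_lt.2 h.le]
  · simp [gammaPDF_of_nonneg h.le, h]

theorem expMeasure_Iic_zero (r : ℝ) : expMeasure r (Iic 0) = 0 := by
  rw [expMeasure_eq, measureOfDensity, withDensity_apply _ measurableSet_Iic,
    Measure.restrict_restrict measurableSet_Iic]
  simp [Iic_inter_Ioi]

theorem integrable_id_expMeasure {r : ℝ} (hr : 0 < r) :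
    Integrable (fun x => x) (expMeasure r) := by
  rw [expMeasure_eq, measureOfDensity, integrable_withDensity_iff (by fun_prop)
    (ae_of_all _ fun _ => ENNReal.ofReal_lt_top)]
  have := (integrableOn_rpow_mul_exp_neg_mul_rpow (s := 1) (p := 1) (b := r) (by norm_num)
    one_pos hr).const_mul r
  refine this.congr ?_
  filter_upwards [ae_restrict_mem measurableSet_Ioi] with x hx
  rw [ENNReal.toReal_ofReal (by positivity)]
  simp
  ring

theorem integral_id_expMeasure {r : ℝ} (hr : 0 < r) : ∫ x, x ∂(expMeasure r) = r⁻¹ := by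
  rw [expMeasure_eq, measureOfDensity, integral_withDensity_eq_integral_toReal_smul (by fun_prop)
    (ae_of_all _ fun _ => ENNReal.ofReal_lt_top)]
  have := Real.integral_rpow_mul_exp_neg_mul_Ioi (a := 2) (r := r) (by norm_num) hr
  have h2 : ∫ x in Ioi (0:ℝ), (ENNReal.ofReal (r * Real.exp (-(r * x)))).toReal • x =
      r * ∫ x in Ioi (0:ℝ), x ^ ((2:ℝ) - 1) * Real.exp (-(r * x)) := by
    rw [← integral_const_mul]
    refine setIntegral_congr_fun measurableSet_Ioi fun x _ => ?_
    rw [ENNReal.toReal_ofReal (by positivity)]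
    norm_num
    ring
  rw [h2, this]
  rw [Real.Gamma_two]
  norm_num
  field_simp

theorem integral_expMeasure {r : ℝ} (hr : 0 < r) (f : ℝ → ℂ) :
    ∫ a, f a ∂(expMeasure r) = ∫ a in Ioi 0, (r * Real.exp (-(r * a)) : ℝ) * f a := by
  rw [expMeasure_eq, measureOfDensity, integral_withDensity_eq_integral_toReal_smul (by fun_prop)
    (ae_of_all _ fun _ => ENNReal.ofReal_lt_top)]
  refine setIntegral_congr_fun measurableSet_Ioi fun x _ => ?_
  rw [ENNReal.toReal_ofReal (by positivity), Complex.real_smul]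

theorem norm_cexp_mul_mul_I (θ x : ℝ) : ‖Complex.exp (θ * x * Complex.I)‖ = 1 := by
  have : (θ : ℂ) * x * Complex.I = ((θ * x : ℝ) : ℂ) * Complex.I := by push_cast; ring
  rw [this, Complex.norm_exp_ofReal_mul_I]

/-- One step of the Lindley recursion with an exponential interarrival time. -/
theorem integral_cexp_max_expMeasure {r ρ : ℝ} (hr : 0 < r) (hρ : 0 < ρ) (θ : ℝ) {z : ℝ}
    (hz : 0 ≤ z) :
    (ρ * r + θ * Complex.I) *
        ∫ a, Complex.exp (θ * (max 0 (z - a / ρ) : ℝ) * Complex.I) ∂(expMeasure r) =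
      ρ * r * Complex.exp (θ * z * Complex.I) +
        θ * Complex.I * Complex.exp (-(ρ * r * z : ℝ)) := by
  have hz' : 0 ≤ ρ * z := by positivity
  set f : ℝ → ℂ := fun a => (r * Real.exp (-(r * a)) : ℝ) *
    Complex.exp (θ * (max 0 (z - a / ρ) : ℝ) * Complex.I) with hf
  have hexp : IntegrableOn (fun a => r * Real.exp (-(r * a))) (Ioi 0) := by
    simp only [← neg_mul]
    exact (integrableOn_exp_mul_Ioi (show -r < 0 by linarith) 0).const_mul r
  have hint : IntegrableOn f (Ioi 0) := by
    refine Integrable.mono hexp (by fun_prop) (ae_of_all _ fun a => ?_)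
    simp only [f]
    rw [norm_mul, norm_cexp_mul_mul_I, Complex.norm_real, mul_one]
  -- Split at a = ρz, beyond which the maximum is 0.
  rw [integral_expMeasure hr, ← Ioc_union_Ioi_eq_Ioi hz',
    setIntegral_union (Ioc_disjoint_Ioi le_rfl) measurableSet_Ioi
      (hint.mono_set Ioc_subset_Ioi_self) (hint.mono_set (Ioi_subset_Ioi hz'))]
  have h2 : ∫ a in Ioi (ρ * z), f a = Complex.exp (-(ρ * r * z : ℝ)) := by
    have : ∫ a in Ioi (ρ * z), f a = ∫ a in Ioi (ρ * z), ((r * Real.exp (-r * a) : ℝ) : ℂ) := by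
      refine setIntegral_congr_fun measurableSet_Ioi fun a ha => ?_
      have : z - a / ρ ≤ 0 := by
        rw [sub_nonpos, le_div_iff₀ hρ]
        linarith [ha.out]
      simp only [f]
      rw [max_eq_left this]
      simp
    rw [this, integral_complex_ofReal, integral_const_mul, integral_exp_mul_Ioi (by linarith)]
    rw [← Complex.ofReal_neg, ← Complex.ofReal_exp]
    congr 1
    field_simp
  have h1 : (ρ * r + θ * Complex.I) * ∫ a in Ioc 0 (ρ * z), f a =
      ρ * r * (Complex.exp (θ * z * Complex.I) - Complex.exp (-(ρ * r * z : ℝ))) := by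
    set w : ℂ := -(r + θ / ρ * Complex.I) with hw
    have hρ' : (ρ : ℂ) ≠ 0 := by exact_mod_cast hρ.ne'
    have hw0 : w ≠ 0 := by
      intro h
      have := congrArg Complex.re h
      simp [w, ← Complex.ofReal_div] at this
      exact hr.ne' this
    have : ∫ a in Ioc 0 (ρ * z), f a =
        ∫ a in Ioc 0 (ρ * z), r * Complex.exp (θ * z * Complex.I) * Complex.exp (w * a) := by
      refine setIntegral_congr_fun measurableSet_Ioc fun a ha => ?_
      have : 0 ≤ z - a / ρ := by
        rw [sub_nonneg, div_le_iff₀ hρ]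
        linarith [ha.2]
      simp only [f]
      rw [max_eq_right this]
      push_cast
      rw [mul_assoc, mul_assoc (r : ℂ), ← Complex.exp_add, ← Complex.exp_add]
      congr 2
      simp only [w]
      field_simp
      ring
    rw [this, ← intervalIntegral.integral_of_le hz', intervalIntegral.integral_const_mul,
      integral_exp_mul_complex hw0]
    have e1 : w * ((ρ * z : ℝ) : ℂ) = -(ρ * r * z : ℝ) - θ * z * Complex.I := by
      simp only [w]; push_cast; field_simp; ring
    have e2 : (ρ * r + θ * Complex.I : ℂ) = - ρ * w := by
      simp only [w]; field_simp
    rw [e1, e2, Complex.exp_sub]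
    have := Complex.exp_ne_zero (θ * z * Complex.I)
    field_simp
    push_cast
    rw [mul_zero, Complex.exp_zero]
    ring
  rw [mul_add, h1, h2]
  ring

end Kernel

/-! ### From Lindley's equation to the Pollaczek-Khinchine equation -/

section PollaczekKhinchine

variable {β m : Measure ℝ} [IsProbabilityMeasure β] [IsProbabilityMeasure m]

/-- A solution of Lindley's equation satisfies the Pollaczek-Khinchine equation. -/
theorem pollaczek_khinchine (h0 : β (Iic 0) = 0) (hint : Integrable (fun x => x) β)
    (hm0 : m (Iio 0) = 0) {ρ : ℝ} (hρ : 0 < ρ)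
    (hm : m = ((expMeasure (∫ u, u ∂β)⁻¹).prod (β ∗ m)).map fun p => max 0 (p.2 - p.1 / ρ)) :
    (∀ θ, charFun m θ = (1 - ρ : ℝ) + ρ * charFun (excessLaw β) θ * charFun m θ) := by
  have hE := integral_id_pos h0 hint
  set r := (∫ u, u ∂β)⁻¹ with hr
  have hrpos : 0 < r := inv_pos.2 hE
  have := isProbabilityMeasure_expMeasure hrpos
  have := isProbabilityMeasure_excessLaw h0 hint
  -- c will be the mass of the atom at 0. It need not be computed: evaluating the final equation at
  -- θ = 0 gives c = 1 - ρ.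
  set c : ℂ := ∫ z, Complex.exp (-(ρ * r * z : ℝ)) ∂(β ∗ m)
  have hZ : ∀ᵐ z ∂(β ∗ m), 0 ≤ z := by
    rw [Measure.conv, ae_map_iff (by fun_prop) measurableSet_Ici]
    have h1 : ∀ᵐ p ∂(β.prod m), 0 < p.1 :=
      Measure.quasiMeasurePreserving_fst.ae (ae_pos_of_Iic_zero h0)
    have h2 : ∀ᵐ p ∂(β.prod m), p.2 ∉ Iio 0 :=
      Measure.quasiMeasurePreserving_snd.ae (measure_eq_zero_iff_ae_notMem.1 hm0)
    filter_upwards [h1, h2] with p hp1 hp2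
    simp at hp2
    linarith
  have key : ∀ θ : ℝ, (ρ * r + θ * Complex.I) * charFun m θ =
      ρ * r * charFun (β ∗ m) θ + θ * Complex.I * c := by
    intro θ
    conv_lhs => rw [hm]
    rw [charFun_apply_real, integral_map (by fun_prop) (by fun_prop),
      integral_prod_symm, charFun_apply_real, ← integral_const_mul, ← integral_const_mul,
      ← integral_const_mul, ← integral_add]
    · refine integral_congr_ae ?_
      filter_upwards [hZ] with z hz
      exact integral_cexp_max_expMeasure hrpos hρ θ hz
    · refine Integrable.const_mul ?_ _
      exact Integrable.of_bound (C := 1) (by fun_prop)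
        (ae_of_all _ fun x => (norm_cexp_mul_mul_I _ _).le)
    · refine Integrable.const_mul ?_ _
      refine Integrable.of_bound (C := 1) (by fun_prop) ?_
      filter_upwards [hZ] with z hz
      rw [← Complex.ofReal_neg, ← Complex.ofReal_exp, Complex.norm_real]
      simp
      positivity
    · refine Integrable.of_bound (C := 1) (by fun_prop)
        (ae_of_all _ fun x => (norm_cexp_mul_mul_I _ _).le)
  -- Inserting the formula for `charFun β`, with r E[B] = 1, cancels the terms in ρr, and the
  -- remaining factor iθ divides out. The point θ = 0 is recovered by continuity.
  have key2 : ∀ θ : ℝ, θ ≠ 0 →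
      charFun m θ = c + ρ * charFun (excessLaw β) θ * charFun m θ := by
    intro θ hθ
    have h1 := key θ
    have hrE : (r : ℂ) * (∫ u, u ∂β : ℝ) = 1 := by
      rw [hr, ← Complex.ofReal_mul, inv_mul_cancel₀ hE.ne', Complex.ofReal_one]
    rw [charFun_conv, charFun_eq_excessLaw h0 hint] at h1
    have hθI : (θ : ℂ) * Complex.I ≠ 0 := mul_ne_zero (by exact_mod_cast hθ) Complex.I_ne_zero
    refine mul_left_cancel₀ hθI ?_
    linear_combination h1 + ρ * θ * Complex.I * charFun (excessLaw β) θ * charFun m θ * hrE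
  have key3 : ∀ θ : ℝ, charFun m θ = c + ρ * charFun (excessLaw β) θ * charFun m θ := by
    have hc1 : Continuous (charFun m) := continuous_charFun
    have hc2 : Continuous (charFun (excessLaw β)) := continuous_charFun
    have : (fun θ => charFun m θ) = fun θ => c + ρ * charFun (excessLaw β) θ * charFun m θ := by
      refine Continuous.ext_on (dense_compl_singleton (0 : ℝ)) hc1 (by fun_prop) ?_
      exact fun θ hθ => key2 θ hθ
    exact fun θ => congrFun this θ
  have hc : c = (1 - ρ : ℝ) := by
    have := key3 0
    simp only [charFun_zero, probReal_univ] at this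
    push_cast at this ⊢
    linear_combination -this
  intro θ
  rw [← hc]
  exact key3 θ

theorem eq_of_charFun_eq {γ : Measure ℝ} [IsProbabilityMeasure γ] {ρ : ℝ} (hρ : 0 < ρ)
    (hρ1 : ρ < 1) (h : ∀ θ, charFun m θ = (1 - ρ : ℝ) + ρ * charFun γ θ * charFun m θ) :
    m = ENNReal.ofReal (1 - ρ) • Measure.dirac 0 + (ENNReal.ofReal ρ • γ) ∗ m := by
  have : IsFiniteMeasure (ENNReal.ofReal (1 - ρ) • Measure.dirac (0 : ℝ)) :=
    Measure.smul_finite _ ENNReal.ofReal_ne_top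
  have : IsFiniteMeasure (ENNReal.ofReal ρ • γ) := Measure.smul_finite _ ENNReal.ofReal_ne_top
  refine Measure.ext_of_charFun (funext fun θ => ?_)
  have hi : ∀ μ : Measure ℝ, IsFiniteMeasure μ →
      Integrable (fun x : ℝ => Complex.exp (θ * x * Complex.I)) μ := fun μ _ =>
    Integrable.of_bound (C := 1) (by fun_prop) (ae_of_all _ fun x => (norm_cexp_mul_mul_I _ _).le)
  have hs : ∀ a : ℝ, 0 ≤ a → ∀ μ : Measure ℝ, charFun (ENNReal.ofReal a • μ) θ = a * charFun μ θ := by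
    intro a ha μ
    rw [charFun_apply_real, integral_smul_measure, ENNReal.toReal_ofReal ha, charFun_apply_real,
      Complex.real_smul]
  rw [h θ, charFun_apply_real (μ := _ + _), integral_add_measure (hi _ ‹_›) (hi _ inferInstance),
    ← charFun_apply_real, ← charFun_apply_real, charFun_conv, hs _ (by linarith), hs _ hρ.le]
  simp

end PollaczekKhinchine

/-! ### Supremum of the random walk and Lindley's equation -/

/-- The supremum of the random walk with increments `b i - a i / ρ`. -/
noncomputable def walkSup (ρ : ℝ) (a b : ℕ → ℝ) : ℝ :=
  ⨆ n : ℕ, ∑ i ∈ Finset.range n, (b i - a i / ρ)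

theorem measurable_walkSup (ρ : ℝ) :
    Measurable fun p : (ℕ → ℝ) × (ℕ → ℝ) => walkSup ρ p.1 p.2 := by
  unfold walkSup
  exact Measurable.iSup fun n => by fun_prop

theorem walkSup_nonneg {ρ : ℝ} {a b : ℕ → ℝ}
    (h : BddAbove (range fun n : ℕ => ∑ i ∈ Finset.range n, (b i - a i / ρ))) :
    0 ≤ walkSup ρ a b := by
  have := le_ciSup h 0
  rwa [Finset.sum_range_zero] at this

/-- The empty sum contributes 0, and every other partial sum contains the first increment.
Boundedness matters because a real supremum of an unbounded family is 0 by convention. -/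
theorem walkSup_eq_max {ρ : ℝ} {a b : ℕ → ℝ}
    (h : BddAbove (range fun n : ℕ => ∑ i ∈ Finset.range n, (b i - a i / ρ))) :
    walkSup ρ a b =
      max 0 (b 0 + walkSup ρ (fun n => a (n + 1)) (fun n => b (n + 1)) - a 0 / ρ) := by
  have hsucc : ∀ n : ℕ, ∑ i ∈ Finset.range (n + 1), (b i - a i / ρ) =
      ∑ i ∈ Finset.range n, (b (i + 1) - a (i + 1) / ρ) + (b 0 - a 0 / ρ) := fun n =>
    Finset.sum_range_succ' _ n
  have h' : BddAbove (range fun n : ℕ => ∑ i ∈ Finset.range n, (b (i + 1) - a (i + 1) / ρ)) := by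
    obtain ⟨C, hC⟩ := h
    refine ⟨C - (b 0 - a 0 / ρ), ?_⟩
    rintro _ ⟨n, rfl⟩
    have := hC ⟨n + 1, rfl⟩
    simp only [hsucc] at this
    simp only
    linarith
  refine le_antisymm (ciSup_le fun n => ?_) (max_le (walkSup_nonneg h) ?_)
  · cases n with
    | zero => simp
    | succ n =>
      refine le_max_of_le_right ?_
      have := le_ciSup h' n
      simp only [walkSup]
      rw [hsucc]
      linarith
  · have : walkSup ρ (fun n => a (n + 1)) (fun n => b (n + 1)) ≤
        walkSup ρ a b - (b 0 - a 0 / ρ) := by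
      refine ciSup_le fun n => ?_
      have := le_ciSup h (n + 1)
      simp only [hsucc] at this
      simp only [walkSup]
      linarith
    linarith

/-- The averaged walk converges to the negative drift, so the partial sums are eventually negative.
-/
theorem bddAbove_walk {ρ : ℝ} {a b : ℕ → ℝ} {α γ : ℝ}
    (ha : Tendsto (fun n : ℕ => (∑ i ∈ Finset.range n, a i) / n) atTop (𝓝 α))
    (hb : Tendsto (fun n : ℕ => (∑ i ∈ Finset.range n, b i) / n) atTop (𝓝 γ))
    (h : γ - α / ρ < 0) :
    BddAbove (range fun n : ℕ => ∑ i ∈ Finset.range n, (b i - a i / ρ)) := by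
  have ht := hb.sub (ha.div_const ρ)
  refine IsBoundedUnder.bddAbove_range ⟨0, eventually_map.2 ?_⟩
  filter_upwards [ht.eventually (gt_mem_nhds h), eventually_gt_atTop 0] with n hn hn0
  have hn0' : (0 : ℝ) < n := by exact_mod_cast hn0
  have : ∑ i ∈ Finset.range n, (b i - a i / ρ) =
      n * ((∑ i ∈ Finset.range n, b i) / n - (∑ i ∈ Finset.range n, a i) / n / ρ) := by
    rw [Finset.sum_sub_distrib, ← Finset.sum_div]
    field_simp
  rw [this]
  nlinarith

section InfinitePi

variable (ν : Measure ℝ) [IsProbabilityMeasure ν]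

theorem measurePreserving_head_tail :
    MeasurePreserving (fun a : ℕ → ℝ => (a 0, fun n => a (n + 1)))
      (Measure.infinitePi fun _ => ν) (ν.prod (Measure.infinitePi fun _ => ν)) := by
  -- It is easier to show that the inverse map, prepending a coordinate, carries the product law to
  -- the infinite product, as this can be tested on cylinders.
  set cons : ℝ × (ℕ → ℝ) → ℕ → ℝ := fun p n => Nat.casesOn n p.1 p.2 with hcons
  have hcm : Measurable cons := by
    refine measurable_pi_iff.2 fun n => ?_
    cases n with
    | zero => exact measurable_fst
    | succ n => exact (measurable_pi_apply n).comp measurable_snd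
  have key : (ν.prod (Measure.infinitePi fun _ => ν)).map cons = Measure.infinitePi fun _ => ν := by
    refine Measure.eq_infinitePi _ fun s t ht => ?_
    obtain ⟨N, hN⟩ : ∃ N : ℕ, s ⊆ Finset.range (N + 1) := by
      obtain ⟨N, hN⟩ := s.exists_nat_subset_range
      exact ⟨N, hN.trans (Finset.range_subset_range.2 (Nat.le_succ N))⟩
    classical
    -- Padding with `univ` lets the cylinder be indexed by an initial segment, where head and tail
    -- separate.
    set t' : ℕ → Set ℝ := fun i => if i ∈ s then t i else univ with ht'
    have ht'm : ∀ i, MeasurableSet (t' i) := by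
      intro i
      by_cases h : i ∈ s <;> simp [t', h, ht i]
    have e1 : Set.pi (s : Set ℕ) t = Set.pi (Finset.range (N + 1) : Set ℕ) t' := by
      ext x
      simp only [Set.mem_pi, Finset.mem_coe, t']
      constructor
      · intro h i _
        by_cases hi : i ∈ s
        · simpa [hi] using h i hi
        · simp [hi]
      · intro h i hi
        simpa [hi] using h i (hN hi)
    have e2 : ∏ i ∈ s, ν (t i) = ∏ i ∈ Finset.range (N + 1), ν (t' i) := by
      rw [← Finset.prod_subset hN]
      · exact Finset.prod_congr rfl fun i hi => by simp [t', hi]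
      · intro i _ hi
        simp [t', hi]
    have e3 : cons ⁻¹' Set.pi (Finset.range (N + 1) : Set ℕ) t' =
        t' 0 ×ˢ Set.pi (Finset.range N : Set ℕ) fun i => t' (i + 1) := by
      ext p
      simp only [Set.mem_preimage, Set.mem_pi, Set.mem_prod, Finset.mem_coe, Finset.mem_range]
      constructor
      · intro h
        exact ⟨h 0 (by omega), fun i hi => h (i + 1) (by omega)⟩
      · rintro ⟨h0, h1⟩ i hi
        cases i with
        | zero => exact h0
        | succ i => exact h1 i (by omega)
    rw [e1, e2, Measure.map_apply hcm (MeasurableSet.pi (Finset.countable_toSet _) fun i _ => ht'm i),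
      e3, Measure.prod_prod, Measure.infinitePi_pi _ (fun i _ => ht'm _), Finset.prod_range_succ',
      mul_comm]
  refine ⟨by fun_prop, ?_⟩
  conv_lhs => rw [← key]
  rw [Measure.map_map (by fun_prop) hcm]
  exact Measure.map_id

theorem ae_tendsto_average_infinitePi (hν : Integrable (fun x => x) ν) :
    ∀ᵐ a : ℕ → ℝ ∂(Measure.infinitePi fun _ : ℕ => ν),
      Tendsto (fun n : ℕ => (∑ i ∈ Finset.range n, a i) / n) atTop (𝓝 (∫ x, x ∂ν)) := by
  have hmp := fun i : ℕ => measurePreserving_eval_infinitePi (fun _ : ℕ => ν) i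
  have hI : iIndepFun (fun (i : ℕ) (a : ℕ → ℝ) => a i) (Measure.infinitePi fun _ : ℕ => ν) :=
    iIndepFun_infinitePi (X := fun _ x => x) fun _ => measurable_id
  have h := strong_law_ae_real (μ := Measure.infinitePi fun _ : ℕ => ν) (fun i a => a i)
    ((hmp 0).integrable_comp_of_integrable hν) (fun i j hij => hI.indepFun hij)
    (fun i => ⟨(hmp i).measurable.aemeasurable, (hmp 0).measurable.aemeasurable,
      (hmp i).map_eq.trans (hmp 0).map_eq.symm⟩)
  have e : ∫ a, a 0 ∂(Measure.infinitePi fun _ : ℕ => ν) = ∫ x, x ∂ν := by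
    conv_rhs => rw [← (hmp 0).map_eq,
      integral_map (hmp 0).measurable.aemeasurable (by fun_prop)]
  rw [e] at h
  exact h

end InfinitePi

section Lindley

variable {α β : Measure ℝ} [IsProbabilityMeasure α] [IsProbabilityMeasure β] {ρ : ℝ}

/-- The law of the supremum of the random walk with i.i.d. increments. -/
noncomputable def walkSupLaw (α β : Measure ℝ) (ρ : ℝ) : Measure ℝ :=
  ((Measure.infinitePi fun _ : ℕ => α).prod (Measure.infinitePi fun _ : ℕ => β)).map
    fun p => walkSup ρ p.1 p.2

instance isProbabilityMeasure_walkSupLaw : IsProbabilityMeasure (walkSupLaw α β ρ) :=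
  Measure.isProbabilityMeasure_map (measurable_walkSup ρ).aemeasurable

theorem ae_bddAbove_walk (hα : Integrable (fun x => x) α) (hβ : Integrable (fun x => x) β)
    (h : (∫ x, x ∂β) - (∫ x, x ∂α) / ρ < 0) :
    ∀ᵐ p ∂((Measure.infinitePi fun _ : ℕ => α).prod (Measure.infinitePi fun _ : ℕ => β)),
      BddAbove (range fun n : ℕ => ∑ i ∈ Finset.range n, (p.2 i - p.1 i / ρ)) := by
  filter_upwards [Measure.quasiMeasurePreserving_fst.ae (ae_tendsto_average_infinitePi α hα),
    Measure.quasiMeasurePreserving_snd.ae (ae_tendsto_average_infinitePi β hβ)] with p h1 h2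
  exact bddAbove_walk h1 h2 h

theorem walkSupLaw_Iio_zero (hα : Integrable (fun x => x) α) (hβ : Integrable (fun x => x) β)
    (h : (∫ x, x ∂β) - (∫ x, x ∂α) / ρ < 0) : walkSupLaw α β ρ (Iio 0) = 0 := by
  rw [walkSupLaw, Measure.map_apply (measurable_walkSup ρ) measurableSet_Iio]
  refine measure_eq_zero_iff_ae_notMem.2 ?_
  filter_upwards [ae_bddAbove_walk hα hβ h] with p hp
  simpa using walkSup_nonneg hp

/-- The walk after its first step is independent of that step and has the same law as the whole
walk; the pathwise recursion then becomes an equation for the law. -/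
theorem walkSupLaw_eq (hα : Integrable (fun x => x) α) (hβ : Integrable (fun x => x) β)
    (h : (∫ x, x ∂β) - (∫ x, x ∂α) / ρ < 0) :
    walkSupLaw α β ρ =
      (α.prod (β ∗ walkSupLaw α β ρ)).map fun p => max 0 (p.2 - p.1 / ρ) := by
  have hmw := measurable_walkSup ρ
  refine Measure.ext_of_lintegral _ fun f hf => ?_
  rw [lintegral_map hf (by fun_prop), lintegral_prod _ (by fun_prop)]
  conv_lhs => rw [walkSupLaw, lintegral_map hf hmw]
  have hmp := (measurePreserving_head_tail α).prod (measurePreserving_head_tail β)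
  set Ψ : (ℝ × (ℕ → ℝ)) × (ℝ × (ℕ → ℝ)) → ℝ := fun q =>
    max 0 (q.2.1 + walkSup ρ q.1.2 q.2.2 - q.1.1 / ρ) with hΨ
  have hm1 : Measurable fun q : (ℝ × (ℕ → ℝ)) × (ℝ × (ℕ → ℝ)) => walkSup ρ q.1.2 q.2.2 :=
    hmw.comp (f := fun q : (ℝ × (ℕ → ℝ)) × (ℝ × (ℕ → ℝ)) => (q.1.2, q.2.2)) (by fun_prop)
  have hΨm : Measurable Ψ := by fun_prop
  have e1 : ∫⁻ p, f (walkSup ρ p.1 p.2)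
      ∂((Measure.infinitePi fun _ : ℕ => α).prod (Measure.infinitePi fun _ : ℕ => β)) =
      ∫⁻ q, f (Ψ q) ∂((α.prod (Measure.infinitePi fun _ => α)).prod
        (β.prod (Measure.infinitePi fun _ => β))) := by
    rw [← hmp.map_eq, lintegral_map (by fun_prop) hmp.measurable]
    refine lintegral_congr_ae ?_
    filter_upwards [ae_bddAbove_walk hα hβ h] with p hp
    simp only [Ψ, Prod.map_fst, Prod.map_snd]
    rw [walkSup_eq_max hp]
  rw [e1, lintegral_prod _ (by fun_prop), lintegral_prod _ (by fun_prop)]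
  refine lintegral_congr fun a0 => ?_
  have e2 : ∀ a' : ℕ → ℝ, ∫⁻ y, f (Ψ ((a0, a'), y)) ∂(β.prod (Measure.infinitePi fun _ => β)) =
      ∫⁻ b0, ∫⁻ b', f (Ψ ((a0, a'), (b0, b'))) ∂(Measure.infinitePi fun _ => β) ∂β :=
    fun a' => lintegral_prod _ (by fun_prop)
  simp_rw [e2]
  rw [lintegral_lintegral_swap (by fun_prop), Measure.lintegral_conv (by fun_prop)]
  refine lintegral_congr fun b0 => ?_
  rw [walkSupLaw, lintegral_map (by fun_prop) hmw, lintegral_prod _ (by fun_prop)]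

end Lindley

/-! ### Paths and arrival times -/

section Arrivals

variable {a : ℕ → ℝ}

theorem strictMono_sum_range (ha : ∀ i, 0 < a i) :
    StrictMono fun n : ℕ => ∑ i ∈ Finset.range n, a i :=
  strictMono_nat_of_lt_succ fun n => by
    rw [Finset.sum_range_succ]
    linarith [ha n]

/-- Divergence of the sums makes the counted set an initial segment of ℕ; if it were infinite,
`ncard` would be 0. -/
theorem le_ncard_iff (ha : ∀ i, 0 < a i)
    (ht : Tendsto (fun n : ℕ => ∑ i ∈ Finset.range n, a i) atTop atTop) {t : ℝ} (h0 : 0 ≤ t)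
    (j : ℕ) :
    j ≤ Set.ncard {n : ℕ | ∑ i ∈ Finset.range (n + 1), a i ≤ t} ↔
      ∑ i ∈ Finset.range j, a i ≤ t := by
  have hmono := strictMono_sum_range ha
  have hex : ∃ K : ℕ, t < ∑ i ∈ Finset.range (K + 1), a i := by
    obtain ⟨K, hK⟩ := (ht.eventually (eventually_gt_atTop t)).exists
    exact ⟨K, hK.trans (hmono (Nat.lt_succ_self K))⟩
  classical
  set K := Nat.find hex
  have hset : {n : ℕ | ∑ i ∈ Finset.range (n + 1), a i ≤ t} = (Finset.range K : Set ℕ) := by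
    ext n
    simp only [mem_ofPred_eq, Finset.coe_range, mem_Iio]
    constructor
    · intro h
      by_contra hn
      have : ∑ i ∈ Finset.range (K + 1), a i ≤ ∑ i ∈ Finset.range (n + 1), a i :=
        hmono.monotone (by omega)
      linarith [Nat.find_spec hex]
    · intro h
      exact not_lt.1 (Nat.find_min hex h)
  rw [hset, Set.ncard_coe_finset, Finset.card_range]
  constructor
  · intro h
    cases j with
    | zero => simpa using h0
    | succ j => exact not_lt.1 (Nat.find_min hex (show j < K by omega))
  · intro h
    by_contra hj
    have : ∑ i ∈ Finset.range (K + 1), a i ≤ ∑ i ∈ Finset.range j, a i := hmono.monotone (by omega)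
    linarith [Nat.find_spec hex]

/-- The supremum of the drifted compound Poisson path is attained along the arrival times. -/
theorem iSup_path {b : ℕ → ℝ} {x₀ ρ : ℝ} (hρ : 0 < ρ) (ha : ∀ i, 0 < a i)
    (ht : Tendsto (fun n : ℕ => ∑ i ∈ Finset.range n, a i) atTop atTop) {N : ℝ≥0 → ℕ}
    (hN : ∀ t : ℝ≥0, N t = Set.ncard {n : ℕ | ∑ i ∈ Finset.range (n + 1), a i ≤ (t : ℝ)})
    (hb : BddAbove (range fun n : ℕ => ∑ i ∈ Finset.range n, (b (i + 1) - a i / ρ))) :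
    BddAbove (range fun t : ℝ≥0 =>
      x₀ + ∑ i ∈ Finset.Icc 1 (N (ρ.toNNReal * t)), b i - (t : ℝ)) ∧
    ⨆ t : ℝ≥0, (x₀ + ∑ i ∈ Finset.Icc 1 (N (ρ.toNNReal * t)), b i - (t : ℝ)) =
      x₀ + walkSup ρ a (fun n => b (n + 1)) := by
  have hiff : ∀ (t : ℝ≥0) (j : ℕ), j ≤ N (ρ.toNNReal * t) ↔
      ∑ i ∈ Finset.range j, a i ≤ ρ * t := by
    intro t j
    rw [hN, le_ncard_iff ha ht (NNReal.coe_nonneg _)]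
    simp [hρ.le]
  have hsum : ∀ k : ℕ, ∑ i ∈ Finset.Icc 1 k, b i = ∑ i ∈ Finset.range k, b (i + 1) := by
    intro k
    rw [Finset.range_eq_Ico, Finset.sum_Ico_add' b 0 k 1]
    rfl
  have hS : ∀ k : ℕ, ∑ i ∈ Finset.range k, (b (i + 1) - a i / ρ) =
      ∑ i ∈ Finset.range k, b (i + 1) - (∑ i ∈ Finset.range k, a i) / ρ := by
    intro k
    rw [Finset.sum_sub_distrib, Finset.sum_div]
  have hle : ∀ t : ℝ≥0, x₀ + ∑ i ∈ Finset.Icc 1 (N (ρ.toNNReal * t)), b i - (t : ℝ) ≤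
      x₀ + walkSup ρ a (fun n => b (n + 1)) := by
    intro t
    have h1 := (hiff t _).1 le_rfl
    have h2 := le_ciSup hb (N (ρ.toNNReal * t))
    rw [hS] at h2
    have h3 : (∑ i ∈ Finset.range (N (ρ.toNNReal * t)), a i) / ρ ≤ t := by
      rw [div_le_iff₀ hρ]
      linarith
    rw [hsum]
    simp only [walkSup]
    linarith
  have hbdd : BddAbove (range fun t : ℝ≥0 =>
      x₀ + ∑ i ∈ Finset.Icc 1 (N (ρ.toNNReal * t)), b i - (t : ℝ)) :=
    ⟨_, by rintro _ ⟨t, rfl⟩; exact hle t⟩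
  refine ⟨hbdd, le_antisymm (ciSup_le hle) ?_⟩
  have : walkSup ρ a (fun n => b (n + 1)) ≤
      (⨆ t : ℝ≥0, (x₀ + ∑ i ∈ Finset.Icc 1 (N (ρ.toNNReal * t)), b i - (t : ℝ))) - x₀ := by
    refine ciSup_le fun k => ?_
    have hnn : 0 ≤ (∑ i ∈ Finset.range k, a i) / ρ :=
      div_nonneg (Finset.sum_nonneg fun i _ => (ha i).le) hρ.le
    -- The k-th jump in the time scale of N(ρ·): just after it the path is at the k-th partial sum
    -- of the walk.
    set t : ℝ≥0 := ⟨_, hnn⟩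
    have htv : (t : ℝ) = (∑ i ∈ Finset.range k, a i) / ρ := rfl
    have hρt : ρ * t = ∑ i ∈ Finset.range k, a i := by rw [htv]; field_simp
    have hNt : N (ρ.toNNReal * t) = k := by
      refine le_antisymm ?_ ((hiff t k).2 hρt.ge)
      have := (hiff t _).1 le_rfl
      rw [hρt] at this
      exact (strictMono_sum_range ha).le_iff_le.1 this
    have := le_ciSup hbdd t
    simp only [hNt] at this
    rw [hS, ← hsum, ← htv]
    linarith
  linarith

/-- The `k`-th arrival time of a counting path. -/
noncomputable def arrivalTime (k : ℕ) (n : ℝ≥0 → ℕ) : ℝ :=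
  (⨅ q : ℚ, if k ≤ n (Real.toNNReal q) then (Real.toNNReal q : ℝ≥0∞) else ∞).toReal

/-- Only rational times enter the infimum, so just countably many coordinates of the path are read
and the product σ-algebra suffices. -/
theorem measurable_arrivalTime (k : ℕ) : Measurable (arrivalTime k) := by
  unfold arrivalTime
  refine Measurable.ennreal_toReal (Measurable.iInf fun q => ?_)
  refine Measurable.ite ?_ measurable_const measurable_const
  exact measurableSet_le measurable_const (measurable_pi_apply _)

theorem arrivalTime_eq {k : ℕ} {n : ℝ≥0 → ℕ} {x : ℝ} (hx : 0 ≤ x)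
    (h : ∀ t : ℝ≥0, k ≤ n t ↔ x ≤ t) : arrivalTime k n = x := by
  have : (⨅ q : ℚ, if k ≤ n (Real.toNNReal q) then (Real.toNNReal q : ℝ≥0∞) else ∞) =
      ENNReal.ofReal x := by
    refine le_antisymm ?_ (le_iInf fun q => ?_)
    · refine le_of_forall_gt fun y hy => ?_
      obtain ⟨q, hq0, hxq, hqy⟩ := ENNReal.lt_iff_exists_rat_btwn.1 hy
      refine lt_of_le_of_lt (iInf_le _ q) ?_
      rw [if_pos]
      · exact hqy
      · rw [h]
        have : Real.toNNReal x < Real.toNNReal q := ENNReal.coe_lt_coe.1 hxq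
        exact (Real.le_coe_toNNReal x).trans (by exact_mod_cast this.le)
    · split_ifs with hk
      · rw [h] at hk
        exact ENNReal.coe_le_coe.2 (Real.toNNReal_le_iff_le_coe.2 hk)
      · exact le_top
  rw [arrivalTime, this, ENNReal.toReal_ofReal hx]

end Arrivals

/-! ### The law of the all-time supremum -/

theorem ae_of_hasLaw {Ω S : Type*} [MeasurableSpace Ω] {P : Measure Ω} [MeasurableSpace S]
    {μ : Measure S} {X : Ω → S} (hX : HasLaw X μ P) {p : S → Prop} (h : ∀ᵐ x ∂μ, p x) :
    ∀ᵐ ω ∂P, p (X ω) := by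
  rw [← hX.map_eq] at h
  exact ae_of_ae_map hX.aemeasurable h

section Law

variable {Ω : Type*} [MeasurableSpace Ω] {P : Measure Ω}

/-- The interarrival times are almost surely a measurable function of the counting process. -/
theorem indepFun_interarrival {S : Type*} [MeasurableSpace S] {A : ℕ → Ω → ℝ} {N : ℝ≥0 → Ω → ℕ}
    {Y : Ω → S} (hNY : IndepFun (fun ω t => N t ω) Y P)
    (hpos : ∀ᵐ ω ∂P, ∀ i, 0 < A i ω)
    (hlim : ∀ᵐ ω ∂P, Tendsto (fun n : ℕ => ∑ i ∈ Finset.range n, A i ω) atTop atTop)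
    (hN : ∀ᵐ ω ∂P, ∀ t : ℝ≥0,
        N t ω = Set.ncard {n : ℕ | ∑ i ∈ Finset.range (n + 1), A i ω ≤ (t : ℝ)}) :
    IndepFun (fun ω i => A i ω) Y P := by
  -- Independence from Y is given for the counting process only. It passes to the interarrival times
  -- because they are almost surely differences of arrival times read off that process.
  set Φ : (ℝ≥0 → ℕ) → ℕ → ℝ := fun n k => arrivalTime (k + 1) n - arrivalTime k n
  have hΦ : Measurable Φ := measurable_pi_iff.2 fun k =>
    (measurable_arrivalTime (k + 1)).sub (measurable_arrivalTime k)
  have h := hNY.comp hΦ measurable_id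
  refine h.congr ?_ (ae_of_all _ fun _ => rfl)
  filter_upwards [hpos, hlim, hN] with ω h1 h2 h3
  have hT : ∀ k, arrivalTime k (fun t => N t ω) = ∑ i ∈ Finset.range k, A i ω := fun k =>
    arrivalTime_eq (Finset.sum_nonneg fun i _ => (h1 i).le) fun t => by
      rw [h3]
      exact le_ncard_iff (a := fun i => A i ω) h1 h2 t.2 k
  funext k
  simp only [Function.comp_apply, Φ, hT, Finset.sum_range_succ, add_sub_cancel_left]

variable [IsProbabilityMeasure P] {β : Measure ℝ} [IsProbabilityMeasure β]

/-- The case X₀ = 0: B₀ is not used, and dropping one coordinate of an i.i.d. sequence preserves its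
law. -/
theorem walkSupLaw_eq_map {α : Measure ℝ} [IsProbabilityMeasure α] (ρ : ℝ) :
    ((Measure.infinitePi fun _ : ℕ => α).prod (Measure.infinitePi fun _ : ℕ => β)).map
      (fun p => walkSup ρ p.1 fun n => p.2 (n + 1)) = walkSupLaw α β ρ := by
  have hmp : MeasurePreserving (Prod.map id fun (b : ℕ → ℝ) n => b (n + 1))
      ((Measure.infinitePi fun _ : ℕ => α).prod (Measure.infinitePi fun _ : ℕ => β))
      ((Measure.infinitePi fun _ : ℕ => α).prod (Measure.infinitePi fun _ : ℕ => β)) :=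
    (MeasurePreserving.id _).prod
      (measurePreserving_snd.comp (measurePreserving_head_tail β))
  rw [walkSupLaw]
  conv_rhs => rw [← hmp.map_eq, Measure.map_map (measurable_walkSup ρ) hmp.measurable]
  rfl

/-- The case X₀ = B₀: the initial value is independent of the walk built from B₁, B₂, …. -/
theorem conv_walkSupLaw_eq_map {α : Measure ℝ} [IsProbabilityMeasure α] (ρ : ℝ) :
    ((Measure.infinitePi fun _ : ℕ => α).prod (Measure.infinitePi fun _ : ℕ => β)).map
      (fun p => p.2 0 + walkSup ρ p.1 fun n => p.2 (n + 1)) = β ∗ walkSupLaw α β ρ := by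
  have hmw := measurable_walkSup ρ
  have hmp := (MeasurePreserving.id (Measure.infinitePi fun _ : ℕ => α)).prod
      (measurePreserving_head_tail β)
  have hm1 : Measurable fun p : (ℕ → ℝ) × (ℝ × (ℕ → ℝ)) => walkSup ρ p.1 p.2.2 :=
    hmw.comp (f := fun p : (ℕ → ℝ) × (ℝ × (ℕ → ℝ)) => (p.1, p.2.2)) (by fun_prop)
  have hm2 : Measurable fun p : (ℕ → ℝ) × (ℕ → ℝ) => walkSup ρ p.1 fun n => p.2 (n + 1) :=
    hmw.comp (f := fun p : (ℕ → ℝ) × (ℕ → ℝ) => (p.1, fun n => p.2 (n + 1))) (by fun_prop)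
  refine Measure.ext_of_lintegral _ fun f hf => ?_
  rw [lintegral_map hf (by fun_prop), Measure.lintegral_conv hf]
  have e : ∫⁻ p, f (p.2 0 + walkSup ρ p.1 fun n => p.2 (n + 1))
      ∂((Measure.infinitePi fun _ : ℕ => α).prod (Measure.infinitePi fun _ : ℕ => β)) =
      ∫⁻ p, f (p.2.1 + walkSup ρ p.1 p.2.2)
        ∂((Measure.infinitePi fun _ : ℕ => α).prod (β.prod (Measure.infinitePi fun _ : ℕ => β))) := by
    rw [← hmp.map_eq, lintegral_map (by fun_prop) hmp.measurable]
    rfl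
  rw [e, lintegral_prod _ (by fun_prop)]
  have e2 : ∀ a : ℕ → ℝ, ∫⁻ y, f (y.1 + walkSup ρ a y.2)
      ∂(β.prod (Measure.infinitePi fun _ : ℕ => β)) =
      ∫⁻ b0, ∫⁻ b', f (b0 + walkSup ρ a b') ∂(Measure.infinitePi fun _ => β) ∂β := fun a =>
    lintegral_prod (fun y : ℝ × (ℕ → ℝ) => f (y.1 + walkSup ρ a y.2)) (by fun_prop)
  simp_rw [e2]
  rw [lintegral_lintegral_swap (by fun_prop)]
  refine lintegral_congr fun b0 => ?_
  rw [walkSupLaw, lintegral_map (by fun_prop) hmw, lintegral_prod _ (by fun_prop)]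

/-- Boundedness and law of the all-time supremum. -/
theorem allTimeSup_law {B : ℕ → Ω → ℝ} (hBlaw : ∀ i, HasLaw (B i) β P) (hBindep : iIndepFun B P)
    (hβ : Integrable (fun x => x) β) (hβ0 : β (Iic 0) = 0) {N : ℝ≥0 → Ω → ℕ}
    (hN : IsPoissonProcess (∫ x, x ∂β)⁻¹ N P)
    (hNB : IndepFun (fun ω t => N t ω) (fun ω i => B i ω) P) {ρ : ℝ} (hρ : ρ ∈ Ioo (0 : ℝ) 1) :
    (∀ X₀ : Ω → ℝ, ∀ᵐ ω ∂P, BddAbove (range fun t : ℝ≥0 => driftedCompoundPoisson X₀ B N ρ t ω)) ∧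
    HasLaw (allTimeSup (fun _ => 0) B N ρ) (walkSupLaw (expMeasure (∫ x, x ∂β)⁻¹) β ρ) P ∧
    HasLaw (allTimeSup (B 0) B N ρ) (β ∗ walkSupLaw (expMeasure (∫ x, x ∂β)⁻¹) β ρ) P := by
  have hE := integral_id_pos hβ0 hβ
  set r := (∫ x, x ∂β)⁻¹ with hr
  have hr0 : 0 < r := inv_pos.2 hE
  have := isProbabilityMeasure_expMeasure hr0
  obtain ⟨A, hAi, hAlaw, hNA⟩ := hN.exists_interarrival
  have hdrift : (∫ x, x ∂β) - (∫ x, x ∂(expMeasure r)) / ρ < 0 := by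
    rw [integral_id_expMeasure hr0, hr, inv_inv, sub_neg, lt_div_iff₀ hρ.1]
    nlinarith [hρ.2]
  have hAL : HasLaw (fun ω i => A i ω) (Measure.infinitePi fun _ : ℕ => expMeasure r) P :=
    hAi.hasLaw_infinitePi hAlaw (aemeasurable_pi_iff.2 fun i => (hAlaw i).aemeasurable)
  have hBL : HasLaw (fun ω i => B i ω) (Measure.infinitePi fun _ : ℕ => β) P :=
    hBindep.hasLaw_infinitePi hBlaw (aemeasurable_pi_iff.2 fun i => (hBlaw i).aemeasurable)
  have hpos : ∀ᵐ ω ∂P, ∀ i, 0 < A i ω := ae_all_iff.2 fun i =>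
    ae_of_hasLaw (hAlaw i) (ae_pos_of_Iic_zero (expMeasure_Iic_zero r))
  have hlim : ∀ᵐ ω ∂P, Tendsto (fun n : ℕ => ∑ i ∈ Finset.range n, A i ω) atTop atTop := by
    -- By the strong law the arrival times grow like n/r.
    filter_upwards [ae_of_hasLaw hAL
      (ae_tendsto_average_infinitePi _ (integrable_id_expMeasure hr0))] with ω h
    rw [integral_id_expMeasure hr0] at h
    have := h.pos_mul_atTop (inv_pos.2 hr0) tendsto_natCast_atTop_atTop
    refine this.congr' ?_
    filter_upwards [eventually_gt_atTop 0] with n hn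
    have : (n : ℝ) ≠ 0 := by exact_mod_cast hn.ne'
    field_simp
  have hAB : IndepFun (fun ω i => A i ω) (fun ω i => B i ω) P :=
    indepFun_interarrival hNB hpos hlim hNA
  have hL : HasLaw (fun ω => ((fun i => A i ω), fun i => B i ω))
      ((Measure.infinitePi fun _ : ℕ => expMeasure r).prod (Measure.infinitePi fun _ : ℕ => β)) P := by
    refine ⟨hAL.aemeasurable.prodMk hBL.aemeasurable, ?_⟩
    rw [(indepFun_iff_map_prod_eq_prod_map_map hAL.aemeasurable hBL.aemeasurable).1 hAB,
      hAL.map_eq, hBL.map_eq]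
  have hbdd : ∀ᵐ ω ∂P, BddAbove (range fun n : ℕ =>
      ∑ i ∈ Finset.range n, (B (i + 1) ω - A i ω / ρ)) := by
    have hmp : MeasurePreserving (fun (b : ℕ → ℝ) n => b (n + 1))
        (Measure.infinitePi fun _ : ℕ => β) (Measure.infinitePi fun _ : ℕ => β) :=
      measurePreserving_snd.comp (measurePreserving_head_tail β)
    filter_upwards [ae_of_hasLaw hAL
      (ae_tendsto_average_infinitePi _ (integrable_id_expMeasure hr0)),
      ae_of_hasLaw hBL (hmp.quasiMeasurePreserving.ae (ae_tendsto_average_infinitePi _ hβ))]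
      with ω h1 h2
    exact bddAbove_walk h1 h2 hdrift
  have hpath : ∀ X₀ : Ω → ℝ, ∀ᵐ ω ∂P,
      BddAbove (range fun t : ℝ≥0 => driftedCompoundPoisson X₀ B N ρ t ω) ∧
      allTimeSup X₀ B N ρ ω =
        X₀ ω + walkSup ρ (fun i => A i ω) (fun n => B (n + 1) ω) := by
    intro X₀
    filter_upwards [hpos, hlim, hNA, hbdd] with ω h1 h2 h3 h4
    exact iSup_path (b := fun i => B i ω) hρ.1 h1 h2 (N := fun t => N t ω) h3 h4
  have hm2 : Measurable fun p : (ℕ → ℝ) × (ℕ → ℝ) => walkSup ρ p.1 fun n => p.2 (n + 1) :=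
    (measurable_walkSup ρ).comp
      (f := fun p : (ℕ → ℝ) × (ℕ → ℝ) => (p.1, fun n => p.2 (n + 1))) (by fun_prop)
  have hlaw : ∀ (X₀ : Ω → ℝ) (g : (ℕ → ℝ) × (ℕ → ℝ) → ℝ) (μ : Measure ℝ), Measurable g →
      (∀ ω, g (fun i => A i ω, fun i => B i ω) =
        X₀ ω + walkSup ρ (fun i => A i ω) (fun n => B (n + 1) ω)) →
      ((Measure.infinitePi fun _ : ℕ => expMeasure r).prod
        (Measure.infinitePi fun _ : ℕ => β)).map g = μ →
      HasLaw (allTimeSup X₀ B N ρ) μ P := by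
    intro X₀ g μ hg hgX hμ
    have hae : allTimeSup X₀ B N ρ =ᵐ[P] fun ω => g (fun i => A i ω, fun i => B i ω) := by
      filter_upwards [hpath X₀] with ω h
      rw [h.2, hgX]
    refine ⟨(hg.comp_aemeasurable hL.aemeasurable).congr hae.symm, ?_⟩
    rw [Measure.map_congr hae, ← hμ, ← hL.map_eq,
      AEMeasurable.map_map_of_aemeasurable hg.aemeasurable hL.aemeasurable]
    rfl
  refine ⟨fun X₀ => (hpath X₀).mono fun ω h => h.1, ?_, ?_⟩
  · exact hlaw _ _ _ hm2 (fun ω => by simp) (walkSupLaw_eq_map ρ)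
  · exact hlaw _ _ _ (by fun_prop) (fun ω => rfl) (conv_walkSupLaw_eq_map ρ)

end Law

/-! ### Continuity of the densities -/

theorem toReal_setLIntegral_Iio {q : ℝ → ℝ≥0∞} (hq : Measurable q) (hfin : ∀ x, q x ≠ ∞)
    (h0 : ∀ x ≤ 0, q x = 0) {x : ℝ} (hx : 0 < x) :
    (∫⁻ s in Iio x, q s).toReal = ∫ s in (0 : ℝ)..x, (q s).toReal := by
  rw [intervalIntegral.integral_of_le hx.le, integral_Ioc_eq_integral_Ioo,
    integral_toReal hq.aemeasurable (ae_of_all _ fun s => (hfin s).lt_top)]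
  congr 1
  rw [← lintegral_indicator measurableSet_Iio, ← lintegral_indicator measurableSet_Ioo]
  refine lintegral_congr fun s => ?_
  by_cases h1 : 0 < s
  · simp [indicator_apply, h1]
  · simp [indicator_apply, h0 s (not_lt.1 h1)]

namespace DFRRenewal

variable {b G T r : ℝ → ℝ≥0∞} {c : ℝ≥0∞} {K : ℝ} {m : Measure ℝ}

theorem conv_G_fin (h : DFRRenewal b G T r c K m) (x : ℝ) : convMeasure G m x ≠ ∞ :=
  ne_top_of_le_ne_top ENNReal.ofReal_ne_top (h.conv_G_le x)

theorem conv_G_zero (h : DFRRenewal b G T r c K m) {x : ℝ} (hx : x ≤ 0) : convMeasure G m x = 0 :=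
  convMeasure_eq_zero h.G_zero h.m_neg hx

theorem conv_b_zero (h : DFRRenewal b G T r c K m) {x : ℝ} (hx : x ≤ 0) : convMeasure b m x = 0 :=
  convMeasure_eq_zero h.b_zero h.m_neg hx

/-- The integrated equation expresses G ∗ m on (0,∞) through primitives of integrable functions. -/
theorem continuousAt_conv_G (h : DFRRenewal b G T r c K m) {x : ℝ} (hx : 0 < x) :
    ContinuousAt (convMeasure G m) x := by
  have hpi : Integrable fun s => (convMeasure b m s).toReal :=
    integrable_toReal_of_lintegral_ne_top h.measurable_conv_b.aemeasurable
      (h.lintegral_conv_b ▸ h.lintegral_b)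
  have hui : Integrable fun s => (convMeasure G m s).toReal :=
    integrable_toReal_of_lintegral_ne_top h.measurable_conv_G.aemeasurable
      (ne_top_of_le_ne_top ENNReal.one_ne_top h.lintegral_conv_G_le)
  have heq : ∀ y, 0 < y → convMeasure G m y = ENNReal.ofReal
      (K * (c.toReal + ∫ s in (0 : ℝ)..y, (convMeasure G m s).toReal) -
        ∫ s in (0 : ℝ)..y, (convMeasure b m s).toReal) := by
    intro y hy
    have hP : ∫⁻ s in Iio y, convMeasure b m s ≠ ∞ :=
      ne_top_of_le_ne_top h.lintegral_b (h.lintegral_conv_b ▸ setLIntegral_le_lintegral _ _)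
    have hU : ∫⁻ s in Iio y, convMeasure G m s ≠ ∞ :=
      ne_top_of_le_ne_top ENNReal.one_ne_top
        ((setLIntegral_le_lintegral _ _).trans h.lintegral_conv_G_le)
    have e := congrArg ENNReal.toReal (h.integrated_eqn hy)
    rw [ENNReal.toReal_add hP (h.conv_G_fin y), ENNReal.toReal_mul, ENNReal.toReal_add h.hc hU,
      ENNReal.toReal_ofReal h.pos.le,
      toReal_setLIntegral_Iio h.measurable_conv_b h.conv_b_fin (fun _ => h.conv_b_zero) hy,
      toReal_setLIntegral_Iio h.measurable_conv_G h.conv_G_fin (fun _ => h.conv_G_zero) hy] at e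
    rw [← e, add_sub_cancel_left, ENNReal.ofReal_toReal (h.conv_G_fin y)]
  have hcont : Continuous fun y => ENNReal.ofReal
      (K * (c.toReal + ∫ s in (0 : ℝ)..y, (convMeasure G m s).toReal) -
        ∫ s in (0 : ℝ)..y, (convMeasure b m s).toReal) := by
    have c1 := intervalIntegral.continuous_primitive (fun a b => hpi.intervalIntegrable) (0 : ℝ)
    have c2 := intervalIntegral.continuous_primitive (fun a b => hui.intervalIntegrable) (0 : ℝ)
    exact ENNReal.continuous_ofReal.comp (by fun_prop)
  refine hcont.continuousAt.congr ?_
  filter_upwards [Ioi_mem_nhds hx] with y hy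
  exact (heq y hy).symm

/-- The translation is moved onto G ∗ m, which is bounded by K and continuous off 0; then K b
dominates the integrand, even if b is unbounded near 0. -/
theorem continuousAt_conv_b (h : DFRRenewal b G T r c K m)
    (hb : ∀ x, 0 < x → ContinuousAt b x) {x : ℝ} (hx : 0 < x) :
    ContinuousAt (convMeasure b m) x := by
  have hbm := h.measurable_b
  have hum := h.measurable_conv_G
  have heq : convMeasure b m = fun x => c * b x + ∫⁻ y, convMeasure G m (x - y) * b y := by
    funext x
    rw [h.conv_b_eq, convMeasure_withDensity_comm hbm hum, convMeasure_withDensity hum hbm]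
  rw [heq]
  refine ContinuousAt.add (ENNReal.Tendsto.const_mul (hb x hx) (Or.inr h.hc)) ?_
  refine tendsto_lintegral_filter_of_dominated_convergence (fun y => ENNReal.ofReal K * b y)
    (Eventually.of_forall fun z => by fun_prop) (Eventually.of_forall fun z => ae_of_all _ fun y => ?_)
    ?_ ?_
  · gcongr
    exact h.conv_G_le _
  · rw [lintegral_const_mul _ hbm]
    exact ENNReal.mul_ne_top ENNReal.ofReal_ne_top h.lintegral_b
  · have : ∀ᵐ y : ℝ, y ≠ x := by simp [ae_iff]
    filter_upwards [this] with y hy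
    refine ENNReal.Tendsto.mul_const ?_ (Or.inr (h.b_fin y))
    have hsub : Tendsto (fun z : ℝ => z - y) (𝓝 x) (𝓝 (x - y)) :=
      (continuous_id.sub continuous_const).tendsto x
    suffices hc : Tendsto (convMeasure G m) (𝓝 (x - y)) (𝓝 (convMeasure G m (x - y))) from
      hc.comp hsub
    rcases lt_or_gt_of_ne hy with hlt | hgt
    · exact h.continuousAt_conv_G (sub_pos.2 hlt)
    · rw [h.conv_G_zero (show x - y ≤ 0 by linarith)]
      refine tendsto_const_nhds.congr' ?_
      filter_upwards [Iio_mem_nhds (show x - y < 0 by linarith)] with z hz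
      exact (h.conv_G_zero (le_of_lt hz)).symm

end DFRRenewal

/-- Continuity of φ makes the derivative exist at every point. Integrating from x/2 keeps away from
0, where the law may have an atom. -/
theorem hasDensityOnPos_of_hasLaw {Ω : Type*} [MeasurableSpace Ω] {P : Measure Ω}
    {M : Ω → ℝ} {μ : Measure ℝ} [IsProbabilityMeasure μ] (hM : HasLaw M μ P) {φ : ℝ → ℝ≥0∞}
    (hφ : Measurable φ) (hfin : ∀ x, φ x ≠ ∞) (hcont : ∀ x, 0 < x → ContinuousAt φ x)
    (hμ : ∀ s, MeasurableSet s → s ⊆ Ioi 0 → μ s = ∫⁻ x in s, φ x) :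
    HasDensityOnPos P M fun x => (φ x).toReal := by
  refine ⟨fun x hx => ?_, fun s hs hs0 => ?_⟩
  · have hx2 : 0 < x / 2 := by linarith
    have hint : IntegrableOn (fun s => (φ s).toReal) (Ioi (x / 2)) := by
      refine integrable_toReal_of_lintegral_ne_top hφ.aemeasurable ?_
      rw [← hμ _ measurableSet_Ioi (Ioi_subset_Ioi hx2.le)]
      exact measure_ne_top _ _
    have heq : ∀ u, x / 2 < u → P.real {ω | M ω < u} =
        μ.real (Iic (x / 2)) + ∫ s in (x / 2)..u, (φ s).toReal := by
      intro u hu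
      have e1 : P.real {ω | M ω < u} = μ.real (Iio u) :=
        hM.measureReal_eq (p := fun y => y < u) measurableSet_Iio
      have e2 : μ.real (Ioo (x / 2) u) = ∫ s in (x / 2)..u, (φ s).toReal := by
        rw [measureReal_def, hμ _ measurableSet_Ioo (fun s hs => hx2.trans hs.1),
          intervalIntegral.integral_of_le hu.le, integral_Ioc_eq_integral_Ioo,
          integral_toReal hφ.aemeasurable (ae_of_all _ fun s => (hfin s).lt_top)]
      rw [e1, ← e2, ← measureReal_union _ measurableSet_Ioo, Iic_union_Ioo_eq_Iio hu]
      exact Set.disjoint_left.2 fun s hs hs' => absurd hs'.1 (not_lt.2 hs)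
    have hd : HasDerivAt (fun u => μ.real (Iic (x / 2)) + ∫ s in (x / 2)..u, (φ s).toReal)
        (φ x).toReal x := by
      refine HasDerivAt.const_add _ (intervalIntegral.integral_hasDerivAt_right ?_ ?_ ?_)
      · rw [intervalIntegrable_iff_integrableOn_Ioc_of_le (by linarith)]
        exact hint.mono_set fun y hy => hy.1
      · exact (hφ.ennreal_toReal.stronglyMeasurable).stronglyMeasurableAtFilter
      · exact (ENNReal.tendsto_toReal (hfin x)).comp (hcont x hx)
    refine hd.congr_of_eventuallyEq ?_
    filter_upwards [Ioi_mem_nhds (show x / 2 < x by linarith)] with u hu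
    exact heq u hu
  · rw [hM.measure_eq (p := fun y => y ∈ s) hs]
    simp only [ENNReal.ofReal_toReal (hfin _)]
    exact hμ s hs hs0

/-! ### The renewal equation of a completely monotone density -/

section Density

variable {f : ℝ → ℝ}

theorem measureOfDensity_Iic_zero (f : ℝ → ℝ) : measureOfDensity f (Iic 0) = 0 := by
  rw [measureOfDensity, withDensity_apply _ measurableSet_Iic,
    Measure.restrict_restrict measurableSet_Iic]
  simp [Iic_inter_Ioi]

theorem measureOfDensity_Ioi (f : ℝ → ℝ) {x : ℝ} (hx : 0 ≤ x) :
    measureOfDensity f (Ioi x) = ∫⁻ y in Ioi x, ENNReal.ofReal (f y) := by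
  rw [measureOfDensity, withDensity_apply _ measurableSet_Ioi,
    Measure.restrict_restrict measurableSet_Ioi, Ioi_inter_Ioi, max_eq_left hx]

theorem measureOfDensity_eq (f : ℝ → ℝ) : measureOfDensity f =
    volume.withDensity ((Ioi 0).indicator fun x => ENNReal.ofReal (f x)) := by
  rw [measureOfDensity, withDensity_indicator measurableSet_Ioi]

theorem CompletelyMonotone.integrableOn (hf : CompletelyMonotone f)
    [IsProbabilityMeasure (measureOfDensity f)] : IntegrableOn f (Ioi 0) := by
  refine ⟨hf.continuousOn.aestronglyMeasurable measurableSet_Ioi, ?_⟩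
  rw [hasFiniteIntegral_iff_ofReal]
  · rw [← measureOfDensity_Ioi f le_rfl]
    exact measure_lt_top _ _
  · filter_upwards [ae_restrict_mem measurableSet_Ioi] with x hx
    exact hf.nonneg hx

theorem CompletelyMonotone.measurable_indicator (hf : CompletelyMonotone f) :
    Measurable ((Ioi 0).indicator f) := by
  classical
  rw [← piecewise_eq_indicator]
  exact hf.continuousOn.measurable_piecewise continuousOn_const measurableSet_Ioi

variable [IsProbabilityMeasure (measureOfDensity f)]

theorem CompletelyMonotone.tail_eq (hf : CompletelyMonotone f) {x : ℝ} (hx : 0 ≤ x) :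
    (measureOfDensity f).real (Ioi x) = 1 - ∫ t in (0 : ℝ)..x, f t := by
  have h1 : (measureOfDensity f).real (Ioi 0) = 1 := by
    have : (measureOfDensity f).real (Iic 0)ᶜ = 1 := by
      rw [probReal_compl_eq_one_sub measurableSet_Iic, measureReal_def, measureOfDensity_Iic_zero]
      simp
    rwa [compl_Iic] at this
  have key : ∀ y, 0 ≤ y → (measureOfDensity f).real (Ioi y) = ∫ t in Ioi y, f t := by
    intro y hy
    rw [measureReal_def, measureOfDensity_Ioi f hy, integral_eq_lintegral_of_nonneg_ae]
    · filter_upwards [ae_restrict_mem measurableSet_Ioi] with t ht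
      exact hf.nonneg (hy.trans_lt ht)
    · exact (hf.integrableOn.mono_set (Ioi_subset_Ioi hy)).aestronglyMeasurable
  rw [key x hx, ← h1, key 0 le_rfl, intervalIntegral.integral_of_le hx,
    ← Ioc_union_Ioi_eq_Ioi hx, setIntegral_union (Ioc_disjoint_Ioi le_rfl) measurableSet_Ioi
      (hf.integrableOn.mono_set Ioc_subset_Ioi_self)
      (hf.integrableOn.mono_set (Ioi_subset_Ioi hx))]
  ring

theorem CompletelyMonotone.hasDerivAt_tail (hf : CompletelyMonotone f) {x : ℝ} (hx : 0 < x) :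
    HasDerivAt (fun y => (measureOfDensity f).real (Ioi y)) (-f x) x := by
  have hca : ContinuousAt f x := hf.continuousOn.continuousAt (Ioi_mem_nhds hx)
  have hd : HasDerivAt (fun y => 1 - ∫ t in (0 : ℝ)..y, f t) (-f x) x := by
    refine HasDerivAt.const_sub _ (intervalIntegral.integral_hasDerivAt_right ?_ ?_ hca)
    · rw [intervalIntegrable_iff_integrableOn_Ioc_of_le hx.le]
      exact hf.integrableOn.mono_set Ioc_subset_Ioi_self
    · exact hf.continuousOn.stronglyMeasurableAtFilter isOpen_Ioi x hx
  refine hd.congr_of_eventuallyEq ?_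
  filter_upwards [Ioi_mem_nhds hx] with y hy
  exact hf.tail_eq (le_of_lt hy)

theorem integrableOn_tail {β : Measure ℝ} [IsProbabilityMeasure β] (h0 : β (Iic 0) = 0)
    (hint : Integrable (fun x => x) β) : IntegrableOn (fun x => β.real (Ioi x)) (Ioi 0) := by
  refine ⟨measurable_measureReal_Ioi.aestronglyMeasurable, ?_⟩
  rw [hasFiniteIntegral_iff_ofReal (ae_of_all _ fun _ => measureReal_nonneg)]
  simp_rw [fun x => ofReal_measureReal (μ := β) (s := Ioi x)]
  rw [lintegral_measure_Ioi h0 hint]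
  exact ENNReal.ofReal_lt_top

theorem setIntegral_tail {β : Measure ℝ} [IsProbabilityMeasure β] (h0 : β (Iic 0) = 0)
    (hint : Integrable (fun x => x) β) : ∫ x in Ioi 0, β.real (Ioi x) = ∫ x, x ∂β := by
  rw [integral_eq_lintegral_of_nonneg_ae (ae_of_all _ fun _ => measureReal_nonneg)
    measurable_measureReal_Ioi.aestronglyMeasurable]
  simp_rw [fun x => ofReal_measureReal (μ := β) (s := Ioi x)]
  rw [lintegral_measure_Ioi h0 hint, ENNReal.toReal_ofReal (integral_id_pos h0 hint).le]

/-- A compound geometric law with completely monotone excess density solves a renewal equation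
with decreasing hazard rate. -/
theorem CompletelyMonotone.exists_dfrRenewal (hf : CompletelyMonotone f)
    (hint : Integrable (fun x => x) (measureOfDensity f)) {ρ : ℝ} (hρ : ρ ∈ Ioo (0 : ℝ) 1)
    {m : Measure ℝ} [IsProbabilityMeasure m] (hm0 : m (Iio 0) = 0)
    (hm : m = ENNReal.ofReal (1 - ρ) • Measure.dirac 0 +
      (ENNReal.ofReal ρ • excessLaw (measureOfDensity f)) ∗ m) :
    ∃ b G T r : ℝ → ℝ≥0∞,
      DFRRenewal b G T r (ENNReal.ofReal (1 - ρ)) (ρ / ∫ u, u ∂(measureOfDensity f)) m ∧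
      b = (Ioi 0).indicator
        fun x => ENNReal.ofReal (ρ / (∫ u, u ∂(measureOfDensity f)) * f x) := by
  set β := measureOfDensity f with hβ
  have h0 : β (Iic 0) = 0 := measureOfDensity_Iic_zero f
  have hE := integral_id_pos h0 hint
  set E := ∫ u, u ∂β with hEdef
  set K := ρ / E with hK
  have hKpos : 0 < K := div_pos hρ.1 hE
  set S : ℝ → ℝ := fun x => β.real (Ioi x) with hS
  have hSm : Measurable S := measurable_measureReal_Ioi
  have hSnn : ∀ x, 0 ≤ S x := fun x => measureReal_nonneg
  have hSi : IntegrableOn S (Ioi 0) := integrableOn_tail h0 hint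
  have hI : ∫ s in Ioi 0, S s = E := setIntegral_tail h0 hint
  have hSint : ∀ x, 0 ≤ x → (∫ s in (0 : ℝ)..x, S s) + ∫ s in Ioi x, S s = E := by
    intro x hx
    rw [← hI, intervalIntegral.integral_of_le hx, ← Ioc_union_Ioi_eq_Ioi hx,
      setIntegral_union (Ioc_disjoint_Ioi le_rfl) measurableSet_Ioi
      (hSi.mono_set Ioc_subset_Ioi_self) (hSi.mono_set (Ioi_subset_Ioi hx))]
  have hIS : ∀ x, 0 ≤ x → IntervalIntegrable S volume 0 x := fun x hx => by
    rw [intervalIntegrable_iff_integrableOn_Ioc_of_le hx]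
    exact hSi.mono_set Ioc_subset_Ioi_self
  -- τ is the survival function of the defective law Γ of mass ρ, so τ(x) = (1-ρ) + K ∫_x^∞ S ≥ 1-ρ
  -- > 0.
  set τ : ℝ → ℝ := fun x => 1 - K * ∫ s in (0 : ℝ)..x, S s with hτ
  have hKE : K * E = ρ := by rw [hK]; field_simp
  have hτ1 : ∀ x, 0 ≤ x → K * ∫ s in Ioi x, S s ≤ τ x := by
    intro x hx
    have := hSint x hx
    have h2 : K * (∫ s in (0 : ℝ)..x, S s) + K * ∫ s in Ioi x, S s = ρ := by
      rw [← mul_add, this, hKE]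
    simp only [τ]
    linarith [hρ.2]
  have hτpos : ∀ x, 0 ≤ x → 0 < τ x := by
    intro x hx
    have := hSint x hx
    have h2 : K * (∫ s in (0 : ℝ)..x, S s) + K * ∫ s in Ioi x, S s = ρ := by
      rw [← mul_add, this, hKE]
    have h3 : 0 ≤ K * ∫ s in Ioi x, S s := mul_nonneg hKpos.le (integral_nonneg fun s => hSnn s)
    simp only [τ]
    linarith [hρ.2]
  have hSd : ∀ x, 0 < x → HasDerivAt S (-f x) x := fun x hx => hf.hasDerivAt_tail hx
  have hτd : ∀ x, 0 < x → HasDerivAt τ (-(K * S x)) x := by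
    intro x hx
    refine HasDerivAt.const_sub _ (HasDerivAt.const_mul _
      (intervalIntegral.integral_hasDerivAt_right (hIS x hx.le) ?_ (hSd x hx).continuousAt))
    exact hSm.stronglyMeasurable.stronglyMeasurableAtFilter
  -- Log-convexity S² ≤ f ∫_x^∞ S combined with K ∫_x^∞ S ≤ τ. The one inequality gives both the
  -- decrease of the hazard rate K S/τ and the bound r G ≤ b.
  have hlogconv : ∀ x, 0 < x → K * S x * S x ≤ f x * τ x := by
    intro x hx
    have h1 := hf.sq_tail_le hf.integrableOn hx
    have e1 : ∫⁻ y in Ioi x, ∫⁻ t in Ioi y, ENNReal.ofReal (f t) =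
        ENNReal.ofReal (∫ s in Ioi x, S s) := by
      rw [ofReal_integral_eq_lintegral_ofReal (hSi.mono_set (Ioi_subset_Ioi hx.le))
        (ae_of_all _ hSnn)]
      refine setLIntegral_congr_fun measurableSet_Ioi fun y hy => ?_
      simp only [S]
      rw [ofReal_measureReal, measureOfDensity_Ioi f (hx.trans hy).le]
    rw [e1, ← measureOfDensity_Ioi f hx.le, ← hβ, ← ofReal_measureReal,
      ← ENNReal.ofReal_pow measureReal_nonneg, ← ENNReal.ofReal_mul (hf.nonneg hx),
      ENNReal.ofReal_le_ofReal_iff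
        (mul_nonneg (hf.nonneg hx) (integral_nonneg fun s => hSnn s))] at h1
    have h2 : S x ^ 2 ≤ f x * ∫ s in Ioi x, S s := h1
    have h3 := mul_le_mul_of_nonneg_left (hτ1 x hx.le) (hf.nonneg hx)
    nlinarith
  have hanti : AntitoneOn (fun x => K * S x / τ x) (Ioi 0) := by
    have hd : ∀ x, 0 < x → HasDerivAt (fun x => K * S x / τ x)
        ((K * -f x * τ x - K * S x * -(K * S x)) / τ x ^ 2) x := fun x hx =>
      ((hSd x hx).const_mul K).div (hτd x hx) (hτpos x hx.le).ne'
    refine antitoneOn_of_deriv_nonpos (convex_Ioi 0)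
      (fun x hx => (hd x hx).continuousAt.continuousWithinAt) ?_ ?_
    · rw [interior_Ioi]
      exact fun x hx => (hd x hx).differentiableAt.differentiableWithinAt
    · rw [interior_Ioi]
      intro x hx
      rw [(hd x hx).deriv]
      refine div_nonpos_of_nonpos_of_nonneg ?_ (sq_nonneg _)
      have := mul_le_mul_of_nonneg_left (hlogconv x hx) hKpos.le
      nlinarith
  have hfm := hf.measurable_indicator
  have hbeq : ((Ioi 0).indicator fun x => ENNReal.ofReal (K * f x)) =
      fun x => ENNReal.ofReal K * (Ioi 0).indicator (fun x => ENNReal.ofReal (f x)) x := by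
    funext x
    by_cases hx : 0 < x <;> simp [hx, ENNReal.ofReal_mul hKpos.le]
  have hfm' : Measurable ((Ioi 0).indicator fun x => ENNReal.ofReal (f x)) := by
    have : ((Ioi 0).indicator fun x => ENNReal.ofReal (f x)) =
        fun x => ENNReal.ofReal ((Ioi 0).indicator f x) := by
      funext x
      by_cases hx : 0 < x <;> simp [hx]
    rw [this]
    exact hfm.ennreal_ofReal
  have hbm : Measurable ((Ioi 0).indicator fun x => ENNReal.ofReal (K * f x)) := by
    rw [hbeq]
    exact hfm'.const_mul _
  have hτm : Measurable ((Ioi 0).indicator fun x => ENNReal.ofReal (τ x)) := by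
    classical
    rw [← piecewise_eq_indicator]
    exact ContinuousOn.measurable_piecewise
      (fun x hx => (ENNReal.continuous_ofReal.continuousAt.comp
        (hτd x hx).continuousAt).continuousWithinAt) continuousOn_const measurableSet_Ioi
  have hGm : Measurable ((Ioi 0).indicator fun x => ENNReal.ofReal (K * S x)) :=
    Measurable.indicator (by fun_prop) measurableSet_Ioi
  refine ⟨(Ioi 0).indicator fun x => ENNReal.ofReal (K * f x),
    (Ioi 0).indicator fun x => ENNReal.ofReal (K * S x),
    (Ioi 0).indicator fun x => ENNReal.ofReal (τ x),
    fun x => ENNReal.ofReal (K * S x / τ x), ?_, rfl⟩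
  constructor
  · exact hKpos
  · exact ENNReal.ofReal_ne_top
  · exact hbm
  · exact hGm
  · exact hτm
  · exact fun x hx => indicator_of_notMem (not_lt.2 hx) _
  · exact fun x hx => indicator_of_notMem (not_lt.2 hx) _
  · intro x
    by_cases hx : 0 < x <;> simp [hx]
  · exact fun x _ => ENNReal.ofReal_ne_top
  · rw [hbeq, lintegral_const_mul _ hfm', lintegral_indicator measurableSet_Ioi,
      ← measureOfDensity_Ioi f le_rfl]
    exact ENNReal.mul_ne_top ENNReal.ofReal_ne_top (measure_ne_top _ _)
  · intro x
    rw [convMeasure_indicator_one hbm]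
    by_cases hx : 0 < x
    · have e1 : ∫⁻ y in Iio x, (Ioi 0).indicator (fun x => ENNReal.ofReal (K * f x)) y =
          ENNReal.ofReal K * β (Iio x) := by
        rw [hbeq, lintegral_const_mul _ hfm', hβ, measureOfDensity_eq,
          withDensity_apply _ measurableSet_Iio]
      have hna : NullSingletonClass β :=
        ⟨fun x => withDensity_absolutelyContinuous _ _ (by simp)⟩
      have e2 : β (Ioi x) + β (Iio x) = 1 := by
        rw [measure_congr (Iio_ae_eq_Iic (μ := β) (a := x)), ← compl_Iic, add_comm]
        exact prob_add_prob_compl measurableSet_Iic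
      rw [e1, indicator_of_mem (show x ∈ Ioi (0 : ℝ) from hx),
        indicator_of_mem (show x ∈ Ioi (0 : ℝ) from hx), ENNReal.ofReal_mul hKpos.le,
        show ENNReal.ofReal (S x) = β (Ioi x) from ofReal_measureReal, ← mul_add, e2]
      rfl
    · have : ∫⁻ y in Iio x, (Ioi 0).indicator (fun x => ENNReal.ofReal (K * f x)) y = 0 := by
        rw [setLIntegral_congr_fun (g := fun _ => 0) measurableSet_Iio, lintegral_zero]
        exact fun y hy => indicator_of_notMem (fun hy0 => hx (lt_trans hy0 hy)) _
      rw [this]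
      simp [hx]
  · intro x
    rw [convMeasure_indicator_one hGm]
    by_cases hx : 0 < x
    · have e1 : ∫⁻ y in Iio x, (Ioi 0).indicator (fun x => ENNReal.ofReal (K * S x)) y =
          ENNReal.ofReal (K * ∫ s in (0 : ℝ)..x, S s) := by
        rw [← intervalIntegral.integral_const_mul, intervalIntegral.integral_of_le hx.le,
          ofReal_integral_eq_lintegral_ofReal
            ((hSi.mono_set Ioc_subset_Ioi_self).const_mul K)
            (ae_of_all _ fun s => mul_nonneg hKpos.le (hSnn s)),
          ← restrict_Ioo_eq_restrict_Ioc, setLIntegral_indicator measurableSet_Ioi, Ioi_inter_Iio]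
      rw [e1, indicator_of_mem (show x ∈ Ioi (0 : ℝ) from hx),
        indicator_of_mem (show x ∈ Ioi (0 : ℝ) from hx), ← ENNReal.ofReal_add (hτpos x hx.le).le]
      · simp [τ]
      · exact mul_nonneg hKpos.le (intervalIntegral.integral_nonneg hx.le fun s _ => hSnn s)
    · have : ∫⁻ y in Iio x, (Ioi 0).indicator (fun x => ENNReal.ofReal (K * S x)) y = 0 := by
        rw [setLIntegral_congr_fun (g := fun _ => 0) measurableSet_Iio, lintegral_zero]
        exact fun y hy => indicator_of_notMem (fun hy0 => hx (lt_trans hy0 hy)) _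
      rw [this]
      simp [hx]
  · intro x hx
    have hp := hτpos x hx.le
    rw [indicator_of_mem (show x ∈ Ioi (0 : ℝ) from hx),
      indicator_of_mem (show x ∈ Ioi (0 : ℝ) from hx),
      ← ENNReal.ofReal_mul (div_nonneg (mul_nonneg hKpos.le (hSnn x)) hp.le),
      div_mul_cancel₀ _ hp.ne']
  · exact fun x y hx hxy => ENNReal.ofReal_le_ofReal (hanti hx (hx.trans_le hxy) hxy)
  · intro x hx
    have hp := hτpos x hx.le
    rw [indicator_of_mem (show x ∈ Ioi (0 : ℝ) from hx),
      indicator_of_mem (show x ∈ Ioi (0 : ℝ) from hx),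
      ← ENNReal.ofReal_mul (div_nonneg (mul_nonneg hKpos.le (hSnn x)) hp.le)]
    refine ENNReal.ofReal_le_ofReal ?_
    rw [div_mul_eq_mul_div, div_le_iff₀ hp]
    nlinarith [mul_le_mul_of_nonneg_left (hlogconv x hx) hKpos.le]
  · infer_instance
  · exact hm0
  · have : ENNReal.ofReal ρ • excessLaw β =
        volume.withDensity ((Ioi 0).indicator fun x => ENNReal.ofReal (K * S x)) := by
      have hm' : Measurable fun x => ENNReal.ofReal (excessDensity β x) :=
        (hSm.div_const _).ennreal_ofReal
      rw [excessLaw, measureOfDensity, withDensity_indicator measurableSet_Ioi,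
        ← withDensity_smul _ hm']
      congr 1
      funext x
      simp only [Pi.smul_apply, smul_eq_mul, excessDensity]
      rw [← ENNReal.ofReal_mul hρ.1.le]
      congr 1
      simp only [K, S]
      ring
    rw [← this]
    exact hm

end Density

/-! ### Weak convergence in heavy traffic -/

theorem charFun_expMeasure {r : ℝ} (hr : 0 < r) (θ : ℝ) :
    charFun (expMeasure r) θ = r / (r - θ * Complex.I) := by
  rw [charFun_apply_real, integral_expMeasure hr]
  have hre : (-(r - θ * Complex.I) : ℂ).re < 0 := by simpa using hr
  have : ∫ a in Ioi (0 : ℝ), (r * Real.exp (-(r * a)) : ℝ) * Complex.exp (θ * a * Complex.I) =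
      ∫ a in Ioi (0 : ℝ), (r : ℂ) * Complex.exp (-(r - θ * Complex.I) * a) := by
    refine setIntegral_congr_fun measurableSet_Ioi fun a _ => ?_
    push_cast
    rw [mul_assoc, ← Complex.exp_add]
    congr 2
    ring
  rw [this, integral_const_mul, integral_exp_mul_complex_Ioi hre, neg_div_neg_eq]
  simp [div_eq_mul_inv]

theorem expMeasure_real_Ioc {r : ℝ} (hr : 0 < r) {a b : ℝ} (ha : 0 ≤ a) (hab : a ≤ b) :
    (expMeasure r).real (Ioc a b) = Real.exp (-(r * a)) - Real.exp (-(r * b)) := by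
  have := isProbabilityMeasure_expMeasure hr
  have h := cdf_expMeasure_eq hr
  simp only [cdf_eq_real] at h
  have hu := measureReal_union (μ := expMeasure r)
    (Iic_disjoint_Ioc le_rfl : Disjoint (Iic a) (Ioc a b)) measurableSet_Ioc
  rw [Iic_union_Ioc_eq_Iic hab, h, h, if_pos ha, if_pos (ha.trans hab)] at hu
  linarith

theorem hasDerivAt_charFun_zero {γ : Measure ℝ} [IsProbabilityMeasure γ]
    (hγ : Integrable (fun x => x) γ) :
    HasDerivAt (charFun γ) (Complex.I * (∫ x, x ∂γ : ℝ)) 0 := by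
  have hL : MemLp id (1 : ℕ) γ := by
    rw [Nat.cast_one, memLp_one_iff_integrable]
    exact hγ
  have hd : DifferentiableAt ℝ (charFun γ) 0 :=
    (contDiff_charFun hL).differentiable (by norm_num) 0
  have h1 := iteratedDeriv_charFun_zero hL
  rw [iteratedDeriv_one] at h1
  have := hd.hasDerivAt
  rw [h1] at this
  simpa using this

/-- Heavy-traffic limit of the characteristic functions. -/
theorem tendsto_charFun_heavyTraffic {γ : Measure ℝ} [IsProbabilityMeasure γ]
    (hγ : Integrable (fun x => x) γ) (hpos : 0 < ∫ x, x ∂γ) {m : ℝ → Measure ℝ}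
    (hm : ∀ ρ ∈ Ioo (0 : ℝ) 1, ∀ θ,
      charFun (m ρ) θ = (1 - ρ : ℝ) + ρ * charFun γ θ * charFun (m ρ) θ) (θ : ℝ) :
    Tendsto (fun ρ : ℝ => charFun (m ρ) ((1 - ρ) * θ)) (𝓝[<] 1)
      (𝓝 (charFun (expMeasure (∫ x, x ∂γ)⁻¹) θ)) := by
  set κ := ∫ x, x ∂γ with hκ
  have hev : ∀ᶠ ρ : ℝ in 𝓝[<] 1, ρ ∈ Ioo (0 : ℝ) 1 := Ioo_mem_nhdsLT one_pos
  have hκ' : (κ : ℂ) ≠ 0 := by exact_mod_cast hpos.ne'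
  have hden : (1 : ℂ) - θ * κ * Complex.I ≠ 0 := by
    intro h
    have := congrArg Complex.re h
    simp at this
  rcases eq_or_ne θ 0 with rfl | hθ
  · rw [charFun_expMeasure (inv_pos.2 hpos)]
    refine tendsto_const_nhds.congr' ?_
    filter_upwards [hev] with ρ hρ
    have h := hm ρ hρ 0
    have h1 : (1 - ρ : ℂ) ≠ 0 := by
      have : (1 - ρ : ℝ) ≠ 0 := by linarith [hρ.2]
      exact_mod_cast this
    simp only [charFun_zero, probReal_univ] at h
    simp only [mul_zero, charFun_zero]
    push_cast at h ⊢
    have h2 : (1 - ρ : ℂ) * ((m ρ).real univ : ℂ) = (1 - ρ : ℂ) * 1 := by linear_combination h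
    rw [mul_left_cancel₀ h1 h2, zero_mul, sub_zero, div_self (inv_ne_zero hκ')]
  · have hε : Tendsto (fun ρ : ℝ => (1 - ρ) * θ) (𝓝[<] 1) (𝓝[≠] 0) := by
      refine tendsto_nhdsWithin_iff.2 ⟨?_, ?_⟩
      · have : Tendsto (fun ρ : ℝ => (1 - ρ) * θ) (𝓝 1) (𝓝 ((1 - 1) * θ)) :=
          Continuous.tendsto (by fun_prop) 1
        rw [sub_self, zero_mul] at this
        exact this.mono_left nhdsWithin_le_nhds
      · filter_upwards [hev] with ρ hρ
        exact mul_ne_zero (by linarith [hρ.2]) hθ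
    have hslope := (hasDerivAt_charFun_zero hγ).tendsto_slope.comp hε
    have hc : Tendsto (fun ρ : ℝ => charFun γ ((1 - ρ) * θ)) (𝓝[<] 1) (𝓝 1) := by
      have hc0 : Continuous (charFun γ) := continuous_charFun
      have := (hc0.tendsto 0).comp (hε.mono_right nhdsWithin_le_nhds)
      simpa [Function.comp_def] using this
    -- At (1-ρ)θ one has 1 - ρ χ_γ = (1-ρ)(χ_γ - θ·slope), with the slope taken from 0. The factor
    -- 1-ρ cancels, and the characteristic function of m is the inverse of the bracket.
    have hlim : Tendsto (fun ρ : ℝ => charFun γ ((1 - ρ) * θ) -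
        θ * slope (charFun γ) 0 ((1 - ρ) * θ)) (𝓝[<] 1) (𝓝 (1 - θ * (Complex.I * κ))) :=
      hc.sub (hslope.const_mul _)
    have hlim2 := hlim.inv₀ (by
      rw [show (θ : ℂ) * (Complex.I * κ) = θ * κ * Complex.I by ring]
      exact hden)
    have e : charFun (expMeasure κ⁻¹) θ = (1 - θ * (Complex.I * κ) : ℂ)⁻¹ := by
      rw [charFun_expMeasure (inv_pos.2 hpos), eq_comm, inv_eq_one_div,
        show (θ : ℂ) * (Complex.I * κ) = θ * κ * Complex.I by ring]
      have h2 : ((κ⁻¹ : ℝ) : ℂ) - θ * Complex.I = κ⁻¹ * (1 - θ * κ * Complex.I) := by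
        push_cast
        field_simp
      rw [h2]
      push_cast
      field_simp
    rw [e]
    refine hlim2.congr' ?_
    filter_upwards [hev] with ρ hρ
    have h := hm ρ hρ ((1 - ρ) * θ)
    have h1 : (1 - ρ : ℂ) ≠ 0 := by
      have : (1 - ρ : ℝ) ≠ 0 := by linarith [hρ.2]
      exact_mod_cast this
    have hθ' : (θ : ℂ) ≠ 0 := by exact_mod_cast hθ
    have hs : (1 - ρ : ℂ) * (θ * slope (charFun γ) 0 ((1 - ρ) * θ)) =
        charFun γ ((1 - ρ) * θ) - 1 := by
      rw [slope_def_module, sub_zero, charFun_zero, probReal_univ, Complex.real_smul]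
      push_cast
      field_simp
    refine inv_eq_of_mul_eq_one_left ?_
    refine mul_left_cancel₀ h1 ?_
    push_cast at h
    linear_combination h - charFun (m ρ) ((1 - ρ) * θ) * hs

/-- Lévy's continuity theorem along sequences tending to 1 from the left, for the image of m under
scaling by 1-ρ. The endpoints of the interval are null for the exponential law. -/
theorem tendsto_measureReal_Ioc_heavyTraffic {γ : Measure ℝ} [IsProbabilityMeasure γ]
    (hγ : Integrable (fun x => x) γ) (hpos : 0 < ∫ x, x ∂γ) {m : ℝ → Measure ℝ}
    [∀ ρ, IsProbabilityMeasure (m ρ)]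
    (hm : ∀ ρ ∈ Ioo (0 : ℝ) 1, ∀ θ,
      charFun (m ρ) θ = (1 - ρ : ℝ) + ρ * charFun γ θ * charFun (m ρ) θ) {a b : ℝ}
    (ha : 0 < a) (hab : a < b) :
    Tendsto (fun ρ : ℝ => (m ρ).real (Ioc (a / (1 - ρ)) (b / (1 - ρ)))) (𝓝[<] 1)
      (𝓝 (Real.exp (-((∫ x, x ∂γ)⁻¹ * a)) - Real.exp (-((∫ x, x ∂γ)⁻¹ * b)))) := by
  have hr := inv_pos.2 hpos
  have hprob := isProbabilityMeasure_expMeasure hr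
  rw [← expMeasure_real_Ioc hr ha.le hab.le]
  refine tendsto_of_seq_tendsto fun ρ hρ => ?_
  set μ : ℕ → ProbabilityMeasure ℝ := fun n =>
    ⟨(m (ρ n)).map (fun x => (1 - ρ n) * x), Measure.isProbabilityMeasure_map (by fun_prop)⟩
  set μ₀ : ProbabilityMeasure ℝ := ⟨expMeasure (∫ x, x ∂γ)⁻¹, hprob⟩
  have hconv : Tendsto μ atTop (𝓝 μ₀) := by
    refine ProbabilityMeasure.tendsto_of_tendsto_charFun fun θ => ?_
    have := (tendsto_charFun_heavyTraffic hγ hpos hm θ).comp hρ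
    refine this.congr fun n => ?_
    simp only [Function.comp_apply, μ, ProbabilityMeasure.coe_mk]
    rw [charFun_map_mul]
  have hna : NullSingletonClass (μ₀ : Measure ℝ) :=
    ⟨fun x => withDensity_absolutelyContinuous _ _ (by simp)⟩
  have hfr : (μ₀ : Measure ℝ) (frontier (Ioc a b)) = 0 := by
    rw [frontier_Ioc hab]
    exact (Set.toFinite {a, b}).measure_zero _
  have h1 := ProbabilityMeasure.tendsto_measure_of_null_frontier_of_tendsto' hconv hfr
  have h2 := (ENNReal.tendsto_toReal (measure_ne_top _ _)).comp h1
  refine h2.congr' ?_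
  have hev : ∀ᶠ n in atTop, ρ n ∈ Ioo (0 : ℝ) 1 := hρ.eventually (Ioo_mem_nhdsLT one_pos)
  filter_upwards [hev] with n hn
  have hε : 0 < 1 - ρ n := by linarith [hn.2]
  simp only [Function.comp_apply, μ, ProbabilityMeasure.coe_mk]
  rw [Measure.map_apply (by fun_prop) measurableSet_Ioc, measureReal_def]
  congr 2
  ext x
  simp only [mem_preimage, mem_Ioc, div_lt_iff₀ hε, le_div_iff₀ hε, mul_comm]

/-! ### From laws to densities -/

/-- Convergence of monotone densities from convergence of the masses of intervals. -/
theorem tendsto_of_antitone_density {ι : Type*} {l : Filter ι} {h : ι → ℝ → ℝ}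
    {D : ι → ℝ → ℝ → ℝ} {Φ : ℝ → ℝ} {d y : ℝ} (hy : 0 < y)
    (hD : ∀ a b, 0 < a → a < b → Tendsto (fun i => D i a b) l (𝓝 (Φ b - Φ a)))
    (hbr : ∀ᶠ i in l, ∀ a b, 0 < a → a < b →
      h i b * (b - a) ≤ D i a b ∧ D i a b ≤ h i a * (b - a))
    (hΦ : HasDerivAt Φ d y) : Tendsto (fun i => h i y) l (𝓝 d) := by
  -- An interval to the right of y bounds h(y) from below and one to its left from above; short
  -- intervals bring the difference quotients of Φ close to d.
  have hslope := hasDerivAt_iff_tendsto_slope.1 hΦ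
  refine tendsto_order.2 ⟨fun u hu => ?_, fun u hu => ?_⟩
  · have h1 := (hslope.mono_left (nhdsGT_le_nhdsNE y)).eventually (lt_mem_nhds hu)
    obtain ⟨z, hz, hzy⟩ := (h1.and self_mem_nhdsWithin).exists
    have hzy' : 0 < z - y := sub_pos.2 hzy
    rw [slope_def_field, lt_div_iff₀ hzy'] at hz
    filter_upwards [(hD y z hy hzy).eventually (lt_mem_nhds hz), hbr] with i hi hi2
    have := (hi2 y z hy hzy).2
    exact lt_of_mul_lt_mul_right (hi.trans_le this) hzy'.le
  · have h1 := (hslope.mono_left (nhdsLT_le_nhdsNE y)).eventually (gt_mem_nhds hu)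
    have h2 : ∀ᶠ z in 𝓝[<] y, z ∈ Ioo 0 y := Ioo_mem_nhdsLT hy
    obtain ⟨z, hz, hz0, hzy⟩ := (h1.and h2).exists
    have hzy' : 0 < y - z := sub_pos.2 hzy
    rw [slope_comm, slope_def_field, div_lt_iff₀ hzy'] at hz
    filter_upwards [(hD z y hz0 hzy).eventually (gt_mem_nhds hz), hbr] with i hi hi2
    have := (hi2 z y hz0 hzy).1
    exact lt_of_mul_lt_mul_right (this.trans_lt hi) hzy'.le

/-- For fixed z < y the upper bound tends to Λ(z), and letting z increase to y closes the gap by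
continuity of Λ. -/
theorem tendsto_of_shifted_bound {ι : Type*} {l : Filter ι} {h w e : ι → ℝ → ℝ} {Λ : ℝ → ℝ} {y : ℝ}
    (hy : 0 < y) (hh : ∀ z, 0 < z → Tendsto (fun i => h i z) l (𝓝 (Λ z)))
    (he : ∀ z, 0 < z → Tendsto (fun i => e i z) l (𝓝 0)) (hΛ : ContinuousAt Λ y)
    (hlow : ∀ᶠ i in l, h i y ≤ w i y)
    (hup : ∀ᶠ i in l, ∀ z, 0 < z → z < y → w i y ≤ h i z + e i (y - z)) :
    Tendsto (fun i => w i y) l (𝓝 (Λ y)) := by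
  refine tendsto_order.2 ⟨fun u hu => ?_, fun u hu => ?_⟩
  · filter_upwards [(hh y hy).eventually (lt_mem_nhds hu), hlow] with i h1 h2
    exact h1.trans_le h2
  · have h1 := (hΛ.tendsto.mono_left (nhdsWithin_le_nhds (s := Iio y))).eventually (gt_mem_nhds hu)
    have h2 : ∀ᶠ z in 𝓝[<] y, z ∈ Ioo 0 y := Ioo_mem_nhdsLT hy
    obtain ⟨z, hz, hz0, hzy⟩ := (h1.and h2).exists
    have h3 := (hh z hz0).add (he (y - z) (sub_pos.2 hzy))
    rw [add_zero] at h3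
    filter_upwards [h3.eventually (gt_mem_nhds hz), hup] with i hi1 hi2
    exact (hi2 z hz0 hzy).trans_lt hi1

/-- E[B] E[B*] = ∫ t P(B > t) dt = E[B²]/2, by the layer-cake formula. -/
theorem integrable_id_excessLaw {β : Measure ℝ} [IsProbabilityMeasure β] (h0 : β (Iic 0) = 0)
    (hint : Integrable (fun x => x) β) (hsq : MemLp (fun x => x) 2 β) :
    Integrable (fun x => x) (excessLaw β) := by
  have hpos := ae_pos_of_Iic_zero h0
  have hE := integral_id_pos h0 hint
  refine ⟨by fun_prop, ?_⟩
  have hm : Measurable fun x => ENNReal.ofReal (excessDensity β x) :=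
    (measurable_measureReal_Ioi.div_const _).ennreal_ofReal
  have h1 : ∫⁻ x, ENNReal.ofReal (x ^ (2 : ℝ)) ∂β ≠ ∞ := by
    have h := hsq.integrable_sq.lintegral_lt_top.ne
    simpa only [Real.rpow_two] using h
  rw [lintegral_rpow_eq_lintegral_meas_lt_mul β (hpos.mono fun x hx => hx.le) aemeasurable_id'
    two_pos] at h1
  have h2 : ∫⁻ t in Ioi 0, β (Ioi t) * ENNReal.ofReal t ≠ ∞ := by
    have e : ∫⁻ t in Ioi (0 : ℝ), β {a | t < a} * ENNReal.ofReal (t ^ ((2 : ℝ) - 1)) =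
        ∫⁻ t in Ioi 0, β (Ioi t) * ENNReal.ofReal t := by
      norm_num [Ioi]
    rw [e] at h1
    exact fun h => h1 (by rw [h]; simp)
  rw [hasFiniteIntegral_iff_enorm, excessLaw, measureOfDensity,
    lintegral_withDensity_eq_lintegral_mul _ hm (by fun_prop)]
  have e : ∫⁻ x in Ioi (0 : ℝ), ((fun x => ENNReal.ofReal (excessDensity β x)) * enorm : ℝ → ℝ≥0∞) x =
      ∫⁻ t in Ioi 0, ENNReal.ofReal (∫ u, u ∂β)⁻¹ * (β (Ioi t) * ENNReal.ofReal t) := by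
    refine setLIntegral_congr_fun measurableSet_Ioi fun x hx => ?_
    simp only [Pi.mul_apply, excessDensity]
    rw [Real.enorm_of_nonneg (le_of_lt hx), div_eq_mul_inv, mul_comm (β.real _),
      ENNReal.ofReal_mul (inv_nonneg.2 hE.le), ofReal_measureReal, mul_assoc]
  rw [e, lintegral_const_mul' _ _ ENNReal.ofReal_ne_top]
  exact ENNReal.mul_lt_top ENNReal.ofReal_lt_top h2.lt_top

namespace DFRRenewal

variable {b G T r : ℝ → ℝ≥0∞} {c : ℝ≥0∞} {K : ℝ} {m : Measure ℝ}

theorem measure_eq_lintegral (h : DFRRenewal b G T r c K m) {s : Set ℝ} (hs : MeasurableSet s)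
    (hs0 : s ⊆ Ioi 0) : m s = ∫⁻ x in s, convMeasure G m x := by
  have h0 : (0 : ℝ) ∉ s := fun h0 => lt_irrefl (0 : ℝ) (hs0 h0)
  calc m s = (c • Measure.dirac 0 + volume.withDensity (convMeasure G m) : Measure ℝ) s := by rw [← h.eqn']
    _ = _ := by
      rw [Measure.add_apply, Measure.smul_apply, Measure.dirac_apply' _ hs,
        withDensity_apply _ hs, indicator_of_notMem h0]
      simp

/-- Split at y = x-δ. Above it m has a density at most its value at x-δ, while q has total mass at
most 1; below it q(x-y) ≤ q(δ), while m has mass at most 1. -/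
theorem convMeasure_le_add (h : DFRRenewal b G T r c K m) {q : ℝ → ℝ≥0∞} (hq : Measurable q)
    (hqa : AntitoneOn q (Ioi 0)) (hq1 : ∫⁻ x, q x ≤ 1)
    {x δ : ℝ} (hδ : 0 < δ) (hδx : δ < x) :
    convMeasure q m x ≤ convMeasure G m (x - δ) + q δ := by
  have := h.prob
  have hxδ : 0 < x - δ := sub_pos.2 hδx
  have hr : m.restrict (Ioi (x - δ)) =
      (volume.restrict (Ioi (x - δ))).withDensity (convMeasure G m) := by
    ext s hs
    rw [Measure.restrict_apply hs, withDensity_apply _ hs, Measure.restrict_restrict hs,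
      h.measure_eq_lintegral (hs.inter measurableSet_Ioi)
        (inter_subset_right.trans (Ioi_subset_Ioi hxδ.le))]
  rw [convMeasure, ← lintegral_add_compl _ (measurableSet_Ioi (a := x - δ)), compl_Ioi, hr,
    lintegral_withDensity_eq_lintegral_mul _ h.measurable_conv_G (by fun_prop)]
  refine add_le_add ?_ ?_
  · calc ∫⁻ y in Ioi (x - δ), (convMeasure G m * fun y => q (x - y)) y
        ≤ ∫⁻ y in Ioi (x - δ), convMeasure G m (x - δ) * q (x - y) :=
          setLIntegral_mono (by fun_prop) fun y hy =>
            mul_le_mul_left (h.conv_G_anti hxδ (le_of_lt hy)) _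
      _ ≤ ∫⁻ y, convMeasure G m (x - δ) * q (x - y) := setLIntegral_le_lintegral _ _
      _ = convMeasure G m (x - δ) * ∫⁻ y, q y := by
          rw [lintegral_const_mul _ (by fun_prop), lintegral_sub_left_eq_self q x]
      _ ≤ _ := mul_le_of_le_one_right' hq1
  · calc ∫⁻ y in Iic (x - δ), q (x - y) ∂m ≤ ∫⁻ y in Iic (x - δ), q δ ∂m :=
          setLIntegral_mono (by fun_prop) fun y hy => by
            have : δ ≤ x - y := by linarith [mem_Iic.1 hy]
            exact hqa hδ (hδ.trans_le this) this
      _ = q δ * m (Iic (x - δ)) := by simp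
      _ ≤ _ := mul_le_of_le_one_right' prob_le_one

end DFRRenewal

/-- `φ` and `ψ` are densities on `(0,∞)` of `m` and of the convolution of `m` with the law of
density `f`, with `φ` decreasing and `ψ` squeezed between `φ` and a shift of `φ`. -/
structure IsDensityPair (f : ℝ → ℝ) (m : Measure ℝ) (φ ψ : ℝ → ℝ≥0∞) : Prop where
  measurable_left : Measurable φ
  measurable_right : Measurable ψ
  ne_top_left : ∀ x, φ x ≠ ∞
  ne_top_right : ∀ x, ψ x ≠ ∞
  continuousAt_left : ∀ x, 0 < x → ContinuousAt φ x
  continuousAt_right : ∀ x, 0 < x → ContinuousAt ψ x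
  measure_eq : ∀ s, MeasurableSet s → s ⊆ Ioi 0 → m s = ∫⁻ x in s, φ x
  conv_eq : ∀ s, MeasurableSet s → s ⊆ Ioi 0 → (measureOfDensity f ∗ m) s = ∫⁻ x in s, ψ x
  anti : ∀ x y, 0 < x → x ≤ y → φ y ≤ φ x
  le_right : ∀ x, φ x ≤ ψ x
  right_le : ∀ x δ, 0 < δ → δ < x → ψ x ≤ φ (x - δ) + ENNReal.ofReal (f δ)

/-- Take φ = G ∗ m and ψ = q ∗ m, with q equal to f cut off to (0,∞). Since b = K q, the inequality
K (G ∗ m) ≤ b ∗ m becomes φ ≤ ψ. -/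
theorem CompletelyMonotone.exists_isDensityPair {f : ℝ → ℝ} (hf : CompletelyMonotone f)
    [IsProbabilityMeasure (measureOfDensity f)]
    (hint : Integrable (fun x => x) (measureOfDensity f)) {ρ : ℝ} (hρ : ρ ∈ Ioo (0 : ℝ) 1)
    {m : Measure ℝ} [IsProbabilityMeasure m] (hm0 : m (Iio 0) = 0)
    (hm : m = ENNReal.ofReal (1 - ρ) • Measure.dirac 0 +
      (ENNReal.ofReal ρ • excessLaw (measureOfDensity f)) ∗ m) :
    ∃ φ ψ, IsDensityPair f m φ ψ := by
  obtain ⟨b, G, T, r, h, hb⟩ := hf.exists_dfrRenewal hint hρ hm0 hm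
  have hK := h.pos
  set K := ρ / ∫ u, u ∂(measureOfDensity f)
  have hK0 : ENNReal.ofReal K ≠ 0 := by simpa using hK
  set q : ℝ → ℝ≥0∞ := (Ioi 0).indicator fun x => ENNReal.ofReal (f x) with hq
  have hqb : q = fun x => (ENNReal.ofReal K)⁻¹ * b x := by
    funext x
    rw [hb]
    by_cases hx : 0 < x
    · simp only [q, mem_Ioi, hx, indicator_of_mem]
      rw [ENNReal.ofReal_mul hK.le, ← mul_assoc,
        ENNReal.inv_mul_cancel hK0 ENNReal.ofReal_ne_top, one_mul]
    · simp [q, hx]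
  have hqm : Measurable q := hqb ▸ h.measurable_b.const_mul _
  have hqc : convMeasure q m = fun x => (ENNReal.ofReal K)⁻¹ * convMeasure b m x := by
    funext x
    rw [hqb, convMeasure_const_mul h.measurable_b]
  have hKi : (ENNReal.ofReal K)⁻¹ ≠ ∞ := ENNReal.inv_ne_top.2 hK0
  have hbc : ∀ x, 0 < x → ContinuousAt b x := by
    intro x hx
    have h1 : ContinuousAt (fun x => ENNReal.ofReal (K * f x)) x :=
      ENNReal.continuous_ofReal.continuousAt.comp
        (continuousAt_const.mul (hf.continuousOn.continuousAt (Ioi_mem_nhds hx)))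
    refine h1.congr ?_
    filter_upwards [Ioi_mem_nhds hx] with y hy
    rw [hb, indicator_of_mem hy]
  have hqa : AntitoneOn q (Ioi 0) := by
    intro x hx y hy hxy
    rw [hq, indicator_of_mem hx, indicator_of_mem hy]
    exact ENNReal.ofReal_le_ofReal (hf.antitoneOn hx hy hxy)
  have hq1 : ∫⁻ x, q x ≤ 1 := by
    rw [hq, lintegral_indicator measurableSet_Ioi, ← measureOfDensity_Ioi f le_rfl]
    exact prob_le_one
  refine ⟨convMeasure G m, convMeasure q m, ?_⟩
  constructor
  · exact h.measurable_conv_G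
  · exact measurable_convMeasure hqm m
  · exact h.conv_G_fin
  · intro x
    rw [hqc]
    exact ENNReal.mul_ne_top hKi (h.conv_b_fin x)
  · exact fun x hx => h.continuousAt_conv_G hx
  · intro x hx
    rw [hqc]
    exact ENNReal.Tendsto.const_mul (h.continuousAt_conv_b hbc hx) (Or.inr hKi)
  · exact fun s hs hs0 => h.measure_eq_lintegral hs hs0
  · intro s hs _
    rw [measureOfDensity_eq, withDensity_conv hqm, withDensity_apply _ hs]
  · exact fun x y hx hxy => h.conv_G_anti hx hxy
  · intro x
    rw [hqc]
    calc convMeasure G m x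
        = (ENNReal.ofReal K)⁻¹ * (ENNReal.ofReal K * convMeasure G m x) := by
          rw [← mul_assoc, ENNReal.inv_mul_cancel hK0 ENNReal.ofReal_ne_top, one_mul]
      _ ≤ _ := mul_le_mul_right (h.conv_G_le_conv_b x) _
  · intro x δ hδ hδx
    have := h.convMeasure_le_add hqm hqa hq1 hδ hδx
    rwa [hq, indicator_of_mem (show δ ∈ Ioi (0 : ℝ) from hδ)] at this

theorem IsDensityPair.measureReal_Ioc_bounds {f : ℝ → ℝ} {m : Measure ℝ} [IsProbabilityMeasure m]
    {φ ψ : ℝ → ℝ≥0∞} (h : IsDensityPair f m φ ψ) {a b : ℝ} (ha : 0 < a) (hab : a < b) :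
    (φ b).toReal * (b - a) ≤ m.real (Ioc a b) ∧ m.real (Ioc a b) ≤ (φ a).toReal * (b - a) := by
  have hm := h.measure_eq _ measurableSet_Ioc (fun x (hx : x ∈ Ioc a b) => ha.trans hx.1)
  have hc : ∀ x, ENNReal.ofReal ((φ x).toReal * (b - a)) = ∫⁻ _ in Ioc a b, φ x := by
    intro x
    rw [ENNReal.ofReal_mul ENNReal.toReal_nonneg, ENNReal.ofReal_toReal (h.ne_top_left x)]
    simp
  constructor
  · rw [measureReal_def, ← ENNReal.ofReal_le_iff_le_toReal (measure_ne_top _ _), hc, hm]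
    exact setLIntegral_mono h.measurable_left fun x hx => h.anti x b (ha.trans hx.1) hx.2
  · rw [measureReal_def]
    refine ENNReal.toReal_le_of_le_ofReal
      (mul_nonneg ENNReal.toReal_nonneg (sub_pos.2 hab).le) ?_
    rw [hc, hm]
    exact setLIntegral_mono measurable_const fun x hx => h.anti a x ha hx.1.le

/-- Heavy-traffic limit of the densities of compound geometric laws. -/
theorem tendsto_density_heavyTraffic {f : ℝ → ℝ} {γ : Measure ℝ} [IsProbabilityMeasure γ]
    (hγ : Integrable (fun x => x) γ) (hpos : 0 < ∫ x, x ∂γ) {m : ℝ → Measure ℝ}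
    [∀ ρ, IsProbabilityMeasure (m ρ)]
    (hm : ∀ ρ ∈ Ioo (0 : ℝ) 1, ∀ θ,
      charFun (m ρ) θ = (1 - ρ : ℝ) + ρ * charFun γ θ * charFun (m ρ) θ)
    {φ ψ : ℝ → ℝ → ℝ≥0∞} (h : ∀ ρ ∈ Ioo (0 : ℝ) 1, IsDensityPair f (m ρ) (φ ρ) (ψ ρ))
    {y : ℝ} (hy : 0 < y) :
    Tendsto (fun ρ : ℝ => 1 / (1 - ρ) * (φ ρ (y / (1 - ρ))).toReal) (𝓝[<] 1)
      (𝓝 (1 / (∫ x, x ∂γ) * Real.exp (-(y / ∫ x, x ∂γ)))) := by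
  have hev : ∀ᶠ ρ : ℝ in 𝓝[<] 1, ρ ∈ Ioo (0 : ℝ) 1 := Ioo_mem_nhdsLT one_pos
  set κ := ∫ x, x ∂γ
  -- Φ is a primitive of the limit density; only its increments enter.
  refine tendsto_of_antitone_density
    (h := fun ρ z => 1 / (1 - ρ) * (φ ρ (z / (1 - ρ))).toReal)
    (D := fun ρ a b => (m ρ).real (Ioc (a / (1 - ρ)) (b / (1 - ρ))))
    (Φ := fun z => -Real.exp (-(κ⁻¹ * z))) hy (fun a b ha hab => ?_) ?_ ?_
  · rw [neg_sub_neg]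
    exact tendsto_measureReal_Ioc_heavyTraffic hγ hpos hm ha hab
  · filter_upwards [hev] with ρ hρ a b ha hab
    have hε : 0 < 1 - ρ := by linarith [hρ.2]
    have := (h ρ hρ).measureReal_Ioc_bounds (div_pos ha hε) ((div_lt_div_iff_of_pos_right hε).2 hab)
    have e : ∀ t : ℝ, t * (b / (1 - ρ) - a / (1 - ρ)) = 1 / (1 - ρ) * t * (b - a) := by
      intro t
      ring
    rwa [e, e] at this
  · have h1 : HasDerivAt (fun z : ℝ => -(κ⁻¹ * z)) (-(κ⁻¹ * 1)) y :=
      ((hasDerivAt_id y).const_mul κ⁻¹).neg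
    refine h1.exp.neg.congr_deriv ?_
    rw [div_eq_inv_mul y]
    ring

/-- The heavy-traffic limit is not affected by adding an independent initial value. -/
theorem tendsto_conv_density_heavyTraffic {f : ℝ → ℝ} (hf : CompletelyMonotone f)
    (hint : IntegrableOn f (Ioi 0)) {γ : Measure ℝ} [IsProbabilityMeasure γ]
    (hγ : Integrable (fun x => x) γ) (hpos : 0 < ∫ x, x ∂γ) {m : ℝ → Measure ℝ}
    [∀ ρ, IsProbabilityMeasure (m ρ)]
    (hm : ∀ ρ ∈ Ioo (0 : ℝ) 1, ∀ θ,
      charFun (m ρ) θ = (1 - ρ : ℝ) + ρ * charFun γ θ * charFun (m ρ) θ)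
    {φ ψ : ℝ → ℝ → ℝ≥0∞} (h : ∀ ρ ∈ Ioo (0 : ℝ) 1, IsDensityPair f (m ρ) (φ ρ) (ψ ρ))
    {y : ℝ} (hy : 0 < y) :
    Tendsto (fun ρ : ℝ => 1 / (1 - ρ) * (ψ ρ (y / (1 - ρ))).toReal) (𝓝[<] 1)
      (𝓝 (1 / (∫ x, x ∂γ) * Real.exp (-(y / ∫ x, x ∂γ)))) := by
  have hev : ∀ᶠ ρ : ℝ in 𝓝[<] 1, ρ ∈ Ioo (0 : ℝ) 1 := Ioo_mem_nhdsLT one_pos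
  -- A shift from y to z in the limit scale is δ = (y-z)/(1-ρ) in the original scale, with error
  -- f(δ)/(1-ρ).
  refine tendsto_of_shifted_bound
    (h := fun ρ z => 1 / (1 - ρ) * (φ ρ (z / (1 - ρ))).toReal)
    (w := fun ρ z => 1 / (1 - ρ) * (ψ ρ (z / (1 - ρ))).toReal)
    (e := fun ρ z => 1 / (1 - ρ) * f (z / (1 - ρ)))
    (Λ := fun z => 1 / (∫ x, x ∂γ) * Real.exp (-(z / ∫ x, x ∂γ))) hy
    (fun z hz => tendsto_density_heavyTraffic hγ hpos hm h hz) (fun z hz => ?_)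
    (Continuous.continuousAt (by fun_prop)) ?_ ?_
  · have h1 := tendsto_mul_atTop_of_antitoneOn hf.antitoneOn (fun x hx => hf.nonneg hx)
      (hint.mono_set (Ioi_subset_Ioi zero_le_one))
    have h2 : Tendsto (fun ρ : ℝ => z / (1 - ρ)) (𝓝[<] 1) atTop := by
      have h3 : Tendsto (fun ρ : ℝ => 1 - ρ) (𝓝[<] 1) (𝓝[>] 0) := by
        refine tendsto_nhdsWithin_iff.2 ⟨?_, ?_⟩
        · have : Tendsto (fun ρ : ℝ => 1 - ρ) (𝓝 1) (𝓝 (1 - 1)) :=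
            Continuous.tendsto (by fun_prop) 1
          rw [sub_self] at this
          exact this.mono_left nhdsWithin_le_nhds
        · filter_upwards [hev] with ρ hρ
          exact sub_pos.2 hρ.2
      simp_rw [div_eq_mul_inv]
      exact (tendsto_inv_nhdsGT_zero.comp h3).const_mul_atTop hz
    -- The error equals z⁻¹ · x f(x) at x = z/(1-ρ).
    have h3 := (h1.comp h2).const_mul z⁻¹
    rw [mul_zero] at h3
    refine h3.congr fun ρ => ?_
    simp only [Function.comp_apply]
    field_simp
  · filter_upwards [hev] with ρ hρ
    have hε : 0 < 1 - ρ := by linarith [hρ.2]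
    exact mul_le_mul_of_nonneg_left (ENNReal.toReal_mono ((h ρ hρ).ne_top_right _)
      ((h ρ hρ).le_right _)) (by positivity)
  · filter_upwards [hev] with ρ hρ z hz hzy
    have hε : 0 < 1 - ρ := by linarith [hρ.2]
    rw [← mul_add]
    refine mul_le_mul_of_nonneg_left ?_ (by positivity)
    have hd : 0 < (y - z) / (1 - ρ) := div_pos (sub_pos.2 hzy) hε
    have h1 := (h ρ hρ).right_le (y / (1 - ρ)) ((y - z) / (1 - ρ)) hd
      ((div_lt_div_iff_of_pos_right hε).2 (by linarith))
    rw [← sub_div, sub_sub_cancel] at h1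
    have h2 := ENNReal.toReal_mono
      (ENNReal.add_ne_top.2 ⟨(h ρ hρ).ne_top_left _, ENNReal.ofReal_ne_top⟩) h1
    rwa [ENNReal.toReal_add ((h ρ hρ).ne_top_left _) ENNReal.ofReal_ne_top,
      ENNReal.toReal_ofReal (hf.nonneg hd)] at h2

/-! ### The main theorem -/

theorem lemma6 {Ω : Type*} [MeasurableSpace Ω] (P : Measure Ω) [IsProbabilityMeasure P]
    (fB : ℝ → ℝ) (hfB : CompletelyMonotone fB)
    (B : ℕ → Ω → ℝ) (hBlaw : ∀ i, HasLaw (B i) (measureOfDensity fB) P)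
    (hBindep : iIndepFun B P) (hBvar : MemLp (B 0) 2 P)
    (N : ℝ≥0 → Ω → ℕ) (hN : IsPoissonProcess (∫ ω, B 0 ω ∂P)⁻¹ N P)
    (hNB : IndepFun (fun ω t => N t ω) (fun ω i => B i ω) P)
    (X₀ : Ω → ℝ) (hX₀ : X₀ = B 0 ∨ X₀ = fun _ => 0) :
    ∃ fM : ℝ → ℝ → ℝ,
      (∀ ρ ∈ Ioo (0 : ℝ) 1,
        (∀ᵐ ω ∂P, BddAbove (range fun t : ℝ≥0 => driftedCompoundPoisson X₀ B N ρ t ω)) ∧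
        HasDensityOnPos P (allTimeSup X₀ B N ρ) (fM ρ)) ∧
      ∀ y : ℝ, 0 < y →
        Tendsto (fun ρ : ℝ => 1 / (1 - ρ) * fM ρ (y / (1 - ρ))) (𝓝[<] 1)
          (𝓝 (1 / (∫ x, x ∂(excessLaw (measureOfDensity fB))) *
            Real.exp (-(y / ∫ x, x ∂(excessLaw (measureOfDensity fB)))))) := by
  have hprob : IsProbabilityMeasure (measureOfDensity fB) :=
    (hBlaw 0).map_eq ▸ Measure.isProbabilityMeasure_map (hBlaw 0).aemeasurable
  have hfint := hfB.integrableOn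
  set β := measureOfDensity fB with hβ
  have h0 : β (Iic 0) = 0 := measureOfDensity_Iic_zero fB
  have hsq : MemLp (fun x => x) 2 β := by
    rw [← (hBlaw 0).map_eq]
    exact (memLp_map_measure_iff (by fun_prop) (hBlaw 0).aemeasurable).2 hBvar
  have hint : Integrable (fun x => x) β := hsq.integrable one_le_two
  have hE := integral_id_pos h0 hint
  rw [(hBlaw 0).integral_eq] at hN
  set r := (∫ x, x ∂β)⁻¹ with hr
  have hr0 : 0 < r := inv_pos.2 hE
  have := isProbabilityMeasure_expMeasure hr0
  have hexcess := isProbabilityMeasure_excessLaw h0 hint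
  have hγ := integrable_id_excessLaw h0 hint hsq
  have hγpos : 0 < ∫ x, x ∂(excessLaw β) :=
    integral_id_pos (measureOfDensity_Iic_zero _) hγ
  have hdrift : ∀ ρ ∈ Ioo (0 : ℝ) 1,
      (∫ x, x ∂β) - (∫ x, x ∂(expMeasure r)) / ρ < 0 := by
    intro ρ hρ
    rw [integral_id_expMeasure hr0, hr, inv_inv, sub_neg, lt_div_iff₀ hρ.1]
    nlinarith [hρ.2]
  set m : ℝ → Measure ℝ := fun ρ => walkSupLaw (expMeasure r) β ρ with hmdef
  have hmprob : ∀ ρ, IsProbabilityMeasure (m ρ) := fun ρ => isProbabilityMeasure_walkSupLaw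
  have hα := integrable_id_expMeasure hr0
  have hm0 : ∀ ρ ∈ Ioo (0 : ℝ) 1, m ρ (Iio 0) = 0 := fun ρ hρ =>
    walkSupLaw_Iio_zero hα hint (hdrift ρ hρ)
  have hm : ∀ ρ ∈ Ioo (0 : ℝ) 1, ∀ θ, charFun (m ρ) θ =
      (1 - ρ : ℝ) + ρ * charFun (excessLaw β) θ * charFun (m ρ) θ := fun ρ hρ =>
    pollaczek_khinchine h0 hint (hm0 ρ hρ) hρ.1 (walkSupLaw_eq hα hint (hdrift ρ hρ))
  -- Stated for all ρ so that `choose` yields functions of ρ alone; outside (0,1) the zero functions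
  -- serve as a default.
  have hex : ∀ ρ : ℝ, ∃ φ ψ, ρ ∈ Ioo (0 : ℝ) 1 → IsDensityPair fB (m ρ) φ ψ := by
    intro ρ
    by_cases hρ : ρ ∈ Ioo (0 : ℝ) 1
    · have : IsProbabilityMeasure (measureOfDensity fB) := hprob
      obtain ⟨φ, ψ, h⟩ := hfB.exists_isDensityPair hint hρ (hm0 ρ hρ)
        (eq_of_charFun_eq hρ.1 hρ.2 (hm ρ hρ))
      exact ⟨φ, ψ, fun _ => h⟩
    · exact ⟨0, 0, fun h => absurd h hρ⟩
  choose φ ψ hpair using hex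
  have hlaw := fun ρ (hρ : ρ ∈ Ioo (0 : ℝ) 1) => allTimeSup_law hBlaw hBindep hint h0 hN hNB hρ
  -- Starting from B₀ the density is ψ, that of β ∗ m; starting from 0 it is φ, that of m away from
  -- its atom.
  rcases hX₀ with rfl | rfl
  · refine ⟨fun ρ x => (ψ ρ x).toReal, fun ρ hρ => ⟨(hlaw ρ hρ).1 _, ?_⟩, fun y hy => ?_⟩
    · have h := hpair ρ hρ
      exact hasDensityOnPos_of_hasLaw (hlaw ρ hρ).2.2 h.measurable_right h.ne_top_right
        h.continuousAt_right h.conv_eq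
    · exact tendsto_conv_density_heavyTraffic hfB hfint hγ hγpos hm hpair hy
  · refine ⟨fun ρ x => (φ ρ x).toReal, fun ρ hρ => ⟨(hlaw ρ hρ).1 _, ?_⟩, fun y hy => ?_⟩
    · have h := hpair ρ hρ
      exact hasDensityOnPos_of_hasLaw (hlaw ρ hρ).2.1 h.measurable_left h.ne_top_left
        h.continuousAt_left h.measure_eq
    · exact tendsto_density_heavyTraffic hγ hγpos hm hpair hy
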